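/- Let $n,m,s,p\ge 0$ and let $\Lambda^{uv}=(A,B^u,B^v,C,D^u)$ be a linear control system $\dot x=Ax+B^uu+B^vv$, $y=Cx+D^uu$ with two kinds of inputs $u\in\mathbb R^m$, $v\in\mathbb R^s$, where $A\in\mathbb R^{n\times n}$, $B^u\in\mathbb R^{n\times m}$, $B^v\in\mathbb R^{n\times s}$, $C\in\mathbb R^{p\times n}$, $D^u\in\mathbb R^{p\times m}$ are arbitrary. An extended Morse transformation is an 8-tuple $(T_x,T_u,T_v,T_y,F_u,F_v,R,K)$ of real matrices with $T_x\in Gl(n,\mathbb R)$, $T_u\in Gl(m,\mathbb R)$, $T_v\in Gl(s,\mathbb R)$, $T_y\in Gl(p,\mathbb R)$, $F_u\in\mathbb R^{m\times n}$, $F_v\in\mathbb R^{s\times n}$, $R\in\mathbb R^{s\times m}$, $K\in\mathbb R^{n\times p}$; it brings $\Lambda^{uv}$ into $\tilde\Lambda^{\tilde u\tilde v}=(\tilde A,\tilde B^{\tilde u},\tilde B^{\tilde v},\tilde C,\tilde D^{\tilde u})$ (of the same dimensions) if $$\begin{bmatrix}\tilde A&\tilde B^{\tilde u}&\tilde B^{\tilde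 v}\\ \tilde C&\tilde D^{\tilde u}&0\end{bmatrix}=\begin{bmatrix}T_x&T_xK\\0&T_y\end{bmatrix}\begin{bmatrix}A&B^u&B^v\\C&D^u&0\end{bmatrix}\begin{bmatrix}T_x^{-1}&0&0\\F_uT_x^{-1}&T_u^{-1}&0\\(F_v+RF_u)T_x^{-1}&RT_u^{-1}&T_v^{-1}\end{bmatrix}.$$ Two systems $(A,B,C,D)$, $(A',B',C',D')$ with one kind of inputs are Morse equivalent if $$\begin{bmatrix}A'&B'\\C'&D'\end{bmatrix}=\begin{bmatrix}T_x&T_xK\\0&T_y\end{bmatrix}\begin{bmatrix}A&B\\C&D\end{bmatrix}\begin{bmatrix}T_x^{-1}&0\\FT_x^{-1}&T_w^{-1}\end{bmatrix}$$ for some invertible $T_x,T_w,T_y$ and some $F,K$. A system is prime if it is Morse equivalent to finitely many (possibly no) independent chains of integrators, each with its own scalar input $w$ and scalar output $y$: a chain of length $l\ge1$ is $\dot x_1=x_2,\dots,\dot x_{l-1}=x_l,\ \dot x_l=w,\ y=x_1$, and a chain of length $0$ is $y=w$. Theorem. For every $\Lambda^{uv}=(A,B^u,B^v,C,D^u)$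 there are integers $n_i,m_i,s_i,p_i\ge0$ with $n=n_1+n_2+n_3+n_4$, $m=m_1+m_3$, $s=s_1+s_3$, $p=p_3+p_4$, and an extended Morse transformation that brings $\Lambda^{uv}$ into a system $\tilde\Lambda^{\tilde u\tilde v}$ in the extended Morse triangular form $$\begin{bmatrix}\tilde A&\tilde B^{\tilde u}&\tilde B^{\tilde v}\\ \tilde C&\tilde D^{\tilde u}&0\end{bmatrix}=\left[\begin{array}{cccc|cc|cc} \tilde A_1&\tilde A_{12}&\tilde A_{13}&\tilde A_{14}&\tilde B^{\tilde u}_1&\tilde B^{\tilde u}_{12}&\tilde B^{\tilde v}_1&\tilde B^{\tilde v}_{12}\\ 0&\tilde A_2&0&\tilde A_{24}&0&0&0&0\\ 0&0&\tilde A_3&\tilde A_{34}&0&\tilde B^{\tilde u}_3&0&\tilde B^{\tilde v}_3\\ 0&0&0&\tilde A_4&0&0&0&0\\ \hline 0&0&\tilde C_3&\tilde C_{34}&0&\tilde D^{\tilde u}_3&0&0\\ 0&0&0&\tilde C_4&0&0&0&0\end{array}\right],$$ with state blocks of sizes $n_1,n_2,n_3,n_4$, $u$-blocks of sizes $m_1,m_3$,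 $v$-blocks of sizes $s_1,s_3$ and output blocks of sizes $p_3,p_4$, such that the pair $(\tilde A_1,[\tilde B^{\tilde u}_1\ \tilde B^{\tilde v}_1])$ is controllable, the pair $(\tilde C_4,\tilde A_4)$ is observable, and the 4-tuple $(\tilde A_3,[\tilde B^{\tilde u}_3\ \tilde B^{\tilde v}_3],\tilde C_3,[\tilde D^{\tilde u}_3\ 0])$ is prime. -/

import Mathlib

open Matrix

/-- A linear control system `x' = A x + B w`, `y = C x + D w` with one kind of inputs.
State, input and output coordinates are indexed by `X`, `W`, `Y`. -/
structure LinSys (X W Y : Type) where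
  A : Matrix X X ℝ
  B : Matrix X W ℝ
  C : Matrix Y X ℝ
  D : Matrix Y W ℝ

/-- A linear control system `x' = A x + Bu u + Bv v`, `y = C x + Du u` with two kinds of inputs:
controls `u` and driving variables `v`. -/
structure ODECS (X U V Y : Type) where
  A : Matrix X X ℝ
  Bu : Matrix X U ℝ
  Bv : Matrix X V ℝ
  C : Matrix Y X ℝ
  Du : Matrix Y U ℝ

namespace LinSys

variable {X W Y X' W' Y' : Type}

/-- The block matrix `[A B; C D]`. -/
def systemMatrix (S : LinSys X W Y) : Matrix (X ⊕ Y) (X ⊕ W) ℝ :=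
  fromBlocks S.A S.B S.C S.D

/-- Renaming of the coordinates. -/
def reindex (eX : X ≃ X') (eW : W ≃ W') (eY : Y ≃ Y') (S : LinSys X W Y) : LinSys X' W' Y' where
  A := Matrix.reindex eX eX S.A
  B := Matrix.reindex eX eW S.B
  C := Matrix.reindex eY eX S.C
  D := Matrix.reindex eY eW S.D

/-- Morse equivalence: coordinate changes of states, inputs and outputs, state feedback `F` and
output injection `K`. -/
def MorseEquiv [Fintype X] [DecidableEq X] [Fintype W] [DecidableEq W] [Fintype Y] [DecidableEq Y]
    (S S' : LinSys X W Y) : Prop :=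
  ∃ (Tx : GL X ℝ) (Tw : GL W ℝ) (Ty : GL Y ℝ) (F : Matrix W X ℝ) (K : Matrix X Y ℝ),
    S'.systemMatrix =
      fromBlocks (Tx : Matrix X X ℝ) ((Tx : Matrix X X ℝ) * K) 0 (Ty : Matrix Y Y ℝ)
        * S.systemMatrix
        * fromBlocks (↑Tx⁻¹ : Matrix X X ℝ) 0
            (F * (↑Tx⁻¹ : Matrix X X ℝ)) (↑Tw⁻¹ : Matrix W W ℝ)

/-- `k` independent chains of integrators, of lengths `σ 0, …, σ (k - 1)`. A chain of length
`l ≥ 1` is `x₁' = x₂, …, x_{l-1}' = x_l, x_l' = w`, `y = x₁`; a chain of length `0` is the direct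
feedthrough `y = w`. -/
def chains {k : ℕ} (σ : Fin k → ℕ) : LinSys (Σ i : Fin k, Fin (σ i)) (Fin k) (Fin k) where
  A := Matrix.of fun a b => if a.1 = b.1 ∧ (a.2 : ℕ) + 1 = (b.2 : ℕ) then 1 else 0
  B := Matrix.of fun a j => if a.1 = j ∧ (a.2 : ℕ) + 1 = σ a.1 then 1 else 0
  C := Matrix.of fun i b => if i = b.1 ∧ (b.2 : ℕ) = 0 then 1 else 0
  D := Matrix.of fun i j => if i = j ∧ σ i = 0 then 1 else 0

/-- A system is prime if it is Morse equivalent to independent chains of integrators, one for each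
input (and each output). -/
def IsPrime [Fintype X] [DecidableEq X] [Fintype W] [DecidableEq W] [Fintype Y] [DecidableEq Y]
    (S : LinSys X W Y) : Prop :=
  ∃ (k : ℕ) (σ : Fin k → ℕ) (eX : (Σ i : Fin k, Fin (σ i)) ≃ X) (eW : Fin k ≃ W) (eY : Fin k ≃ Y),
    S.MorseEquiv ((chains σ).reindex eX eW eY)

end LinSys

namespace ODECS

variable {X U V Y X' U' V' Y' : Type}

/-- The block matrix `[A Bu Bv; C Du 0]`. -/
def systemMatrix (S : ODECS X U V Y) : Matrix (X ⊕ Y) (X ⊕ (U ⊕ V)) ℝ :=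
  fromBlocks S.A (fromCols S.Bu S.Bv) S.C (fromCols S.Du 0)

/-- Renaming of the coordinates. -/
def reindex (eX : X ≃ X') (eU : U ≃ U') (eV : V ≃ V') (eY : Y ≃ Y') (S : ODECS X U V Y) :
    ODECS X' U' V' Y' where
  A := Matrix.reindex eX eX S.A
  Bu := Matrix.reindex eX eU S.Bu
  Bv := Matrix.reindex eX eV S.Bv
  C := Matrix.reindex eY eX S.C
  Du := Matrix.reindex eY eU S.Du

end ODECS

/-- An extended Morse transformation `(Tx, Tu, Tv, Ty, Fu, Fv, R, K)`. -/
structure EMTran (X U V Y : Type) [Fintype X] [DecidableEq X] [Fintype U] [DecidableEq U]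
    [Fintype V] [DecidableEq V] [Fintype Y] [DecidableEq Y] where
  Tx : GL X ℝ
  Tu : GL U ℝ
  Tv : GL V ℝ
  Ty : GL Y ℝ
  Fu : Matrix U X ℝ
  Fv : Matrix V X ℝ
  R : Matrix V U ℝ
  K : Matrix X Y ℝ

namespace EMTran

variable {X U V Y : Type} [Fintype X] [DecidableEq X] [Fintype U] [DecidableEq U]
  [Fintype V] [DecidableEq V] [Fintype Y] [DecidableEq Y]

/-- The left factor `[Tx, Tx K; 0, Ty]`. -/
def left (T : EMTran X U V Y) : Matrix (X ⊕ Y) (X ⊕ Y) ℝ :=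
  fromBlocks (T.Tx : Matrix X X ℝ) ((T.Tx : Matrix X X ℝ) * T.K) 0 (T.Ty : Matrix Y Y ℝ)

/-- The right factor
`[Tx⁻¹, 0, 0; Fu Tx⁻¹, Tu⁻¹, 0; (Fv + R Fu) Tx⁻¹, R Tu⁻¹, Tv⁻¹]`. -/
def right (T : EMTran X U V Y) : Matrix (X ⊕ (U ⊕ V)) (X ⊕ (U ⊕ V)) ℝ :=
  fromBlocks (↑T.Tx⁻¹ : Matrix X X ℝ) 0
    (fromRows (T.Fu * (↑T.Tx⁻¹ : Matrix X X ℝ))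
      ((T.Fv + T.R * T.Fu) * (↑T.Tx⁻¹ : Matrix X X ℝ)))
    (fromBlocks (↑T.Tu⁻¹ : Matrix U U ℝ) 0
      (T.R * (↑T.Tu⁻¹ : Matrix U U ℝ)) (↑T.Tv⁻¹ : Matrix V V ℝ))

/-- `T` brings the system `S` into the system `S'`. -/
def Brings (T : EMTran X U V Y) (S S' : ODECS X U V Y) : Prop :=
  S'.systemMatrix = T.left * S.systemMatrix * T.right

end EMTran

/-- `(A, B)` is controllable: with `n` the number of states, the reachability space
`Im B + Im AB + … + Im Aⁿ⁻¹B` is the whole state space. -/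
def IsControllable {X W : Type} [Fintype X] [DecidableEq X] [Fintype W]
    (A : Matrix X X ℝ) (B : Matrix X W ℝ) : Prop :=
  (⨆ k : Fin (Fintype.card X), LinearMap.range (A ^ (k : ℕ) * B).mulVecLin) = ⊤

/-- `(C, A)` is observable: with `n` the number of states, the unobservable space
`ker C ∩ ker CA ∩ … ∩ ker CAⁿ⁻¹` is zero. -/
def IsObservable {X Y : Type} [Fintype X] [DecidableEq X]
    (C : Matrix Y X ℝ) (A : Matrix X X ℝ) : Prop :=
  (⨅ k : Fin (Fintype.card X), LinearMap.ker (C * A ^ (k : ℕ)).mulVecLin) = ⊥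

/-- The possibly nonzero blocks of a system in extended Morse triangular form. -/
structure EMTF (n₁ n₂ n₃ n₄ m₁ m₃ s₁ s₃ p₃ p₄ : ℕ) where
  A₁ : Matrix (Fin n₁) (Fin n₁) ℝ
  A₁₂ : Matrix (Fin n₁) (Fin n₂) ℝ
  A₁₃ : Matrix (Fin n₁) (Fin n₃) ℝ
  A₁₄ : Matrix (Fin n₁) (Fin n₄) ℝ
  A₂ : Matrix (Fin n₂) (Fin n₂) ℝ
  A₂₄ : Matrix (Fin n₂) (Fin n₄) ℝ
  A₃ : Matrix (Fin n₃) (Fin n₃) ℝ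
  A₃₄ : Matrix (Fin n₃) (Fin n₄) ℝ
  A₄ : Matrix (Fin n₄) (Fin n₄) ℝ
  Bu₁ : Matrix (Fin n₁) (Fin m₁) ℝ
  Bu₁₂ : Matrix (Fin n₁) (Fin m₃) ℝ
  Bu₃ : Matrix (Fin n₃) (Fin m₃) ℝ
  Bv₁ : Matrix (Fin n₁) (Fin s₁) ℝ
  Bv₁₂ : Matrix (Fin n₁) (Fin s₃) ℝ
  Bv₃ : Matrix (Fin n₃) (Fin s₃) ℝ
  C₃ : Matrix (Fin p₃) (Fin n₃) ℝ
  C₃₄ : Matrix (Fin p₃) (Fin n₄) ℝ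
  C₄ : Matrix (Fin p₄) (Fin n₄) ℝ
  Du₃ : Matrix (Fin p₃) (Fin m₃) ℝ

namespace EMTF

variable {n₁ n₂ n₃ n₄ m₁ m₃ s₁ s₃ p₃ p₄ : ℕ}

/-- The system assembled from the blocks:
```
A  = [A₁ A₁₂ A₁₃ A₁₄; 0 A₂ 0 A₂₄; 0 0 A₃ A₃₄; 0 0 0 A₄]
Bu = [Bu₁ Bu₁₂; 0 0; 0 Bu₃; 0 0]      Bv = [Bv₁ Bv₁₂; 0 0; 0 Bv₃; 0 0]
C  = [0 0 C₃ C₃₄; 0 0 0 C₄]           Du = [0 Du₃; 0 0]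
``` -/
def toODECS (E : EMTF n₁ n₂ n₃ n₄ m₁ m₃ s₁ s₃ p₃ p₄) :
    ODECS (Fin n₁ ⊕ (Fin n₂ ⊕ (Fin n₃ ⊕ Fin n₄))) (Fin m₁ ⊕ Fin m₃) (Fin s₁ ⊕ Fin s₃)
      (Fin p₃ ⊕ Fin p₄) where
  A := fromBlocks E.A₁ (fromCols E.A₁₂ (fromCols E.A₁₃ E.A₁₄)) 0
    (fromBlocks E.A₂ (fromCols 0 E.A₂₄) 0 (fromBlocks E.A₃ E.A₃₄ 0 E.A₄))
  Bu := fromBlocks E.Bu₁ E.Bu₁₂ 0 (fromRows 0 (fromRows E.Bu₃ 0))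
  Bv := fromBlocks E.Bv₁ E.Bv₁₂ 0 (fromRows 0 (fromRows E.Bv₃ 0))
  C := fromCols 0 (fromCols 0 (fromBlocks E.C₃ E.C₃₄ 0 E.C₄))
  Du := fromBlocks 0 E.Du₃ 0 0

/-- The third block as a system with the joint input `w = (u, v)`. -/
def block₃ (E : EMTF n₁ n₂ n₃ n₄ m₁ m₃ s₁ s₃ p₃ p₄) :
    LinSys (Fin n₃) (Fin m₃ ⊕ Fin s₃) (Fin p₃) where
  A := E.A₃
  B := fromCols E.Bu₃ E.Bv₃
  C := E.C₃
  D := fromCols E.Du₃ 0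

end EMTF

/-- Consecutive blocks of sizes `a`, `b` of `n` coordinates, in this order. -/
def blocks₂ {n a b : ℕ} (h : n = a + b) : Fin a ⊕ Fin b ≃ Fin n :=
  finSumFinEquiv.trans (finCongr h.symm)

/-- Consecutive blocks of sizes `a`, `b`, `c`, `d` of `n` coordinates, in this order. -/
def blocks₄ {n a b c d : ℕ} (h : n = a + (b + (c + d))) :
    Fin a ⊕ (Fin b ⊕ (Fin c ⊕ Fin d)) ≃ Fin n :=
  ((Equiv.refl (Fin a)).sumCongr
    (((Equiv.refl (Fin b)).sumCongr finSumFinEquiv).trans finSumFinEquiv)).trans (blocks₂ h)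

/-! First treat the inputs as one space `W = U × V` and work without coordinates. Feedback cancels
the part of the output in the image of the feedthrough `D`, so that after a change of inputs this
part becomes a set of direct channels. The rest of the output is a map `C` of the state alone; its
redundant components are identically zero. All remaining outputs are measured, so output injection
removes their effect and that of the direct channels from the dynamics. What is left is a system
`S₁` with states `ker C`, inputs `ker D` and the derivative of the `C`-output as output
(`exists_morseRel_padOut_ext`). Thus the original system is `S₁` with an integrator behind each
output, plus direct channels, plus zero outputs.

These operations preserve Morse equivalence (`MorseRel.ext`) and triangular form: chains grow by one
integrator, direct channels are chains of length 0, block 4 stays observable and block 1 is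
untouched. If `C ≠ 0`, then `ker C` is smaller and induction applies; if `C = 0`, then `S₁` has no
outputs and its Kalman decomposition is the triangular form.

To respect the splitting into `u` and `v`, note that the input coordinates matter only through the
subspace of `U × V` that carries the inputs of block 1: any change of inputs preserving it is block
triangular, and its off-diagonal part is absorbed by the free blocks in the first row
(`morseRel_transport`). A subspace of `U × V` becomes a coordinate subspace after a change `(u, v) ↦
(u, R u + v)` and choices of bases in `U` and `V` (`exists_adapted_prod`); these are the input
changes that an extended Morse transformation allows. Finally `v` has no feedthrough in the original
system, so none arises in block 3. -/

/-- A coordinate-free linear control system `x' = dyn (x, w)`, `y = out (x, w)`. -/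
structure StateSys (X W Y : Type) [AddCommGroup X] [Module ℝ X] [AddCommGroup W] [Module ℝ W]
    [AddCommGroup Y] [Module ℝ Y] where
  dyn : X × W →ₗ[ℝ] X
  out : X × W →ₗ[ℝ] Y

/-! ### Coordinate-free Morse equivalence, integrator extensions, prime systems -/

namespace StateSys

variable {X W Y X' W' Y' X'' W'' Y'' Q Y₀ : Type}
  [AddCommGroup X] [Module ℝ X] [AddCommGroup W] [Module ℝ W] [AddCommGroup Y] [Module ℝ Y]
  [AddCommGroup X'] [Module ℝ X'] [AddCommGroup W'] [Module ℝ W'] [AddCommGroup Y'] [Module ℝ Y']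
  [AddCommGroup X''] [Module ℝ X''] [AddCommGroup W''] [Module ℝ W'']
  [AddCommGroup Y''] [Module ℝ Y''] [AddCommGroup Q] [Module ℝ Q] [AddCommGroup Y₀] [Module ℝ Y₀]

/-- Morse equivalence of coordinate-free systems, with a prescribed change `N` of inputs. -/
def MorseRel (N : W' ≃ₗ[ℝ] W) (S : StateSys X W Y) (S' : StateSys X' W' Y') : Prop :=
  ∃ (Tx : X ≃ₗ[ℝ] X') (Ty : Y ≃ₗ[ℝ] Y') (F : X →ₗ[ℝ] W) (K : Y →ₗ[ℝ] X),
    ∀ x w, S'.dyn (Tx x, w) = Tx (S.dyn (x, F x + N w) + K (S.out (x, F x + N w))) ∧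
      S'.out (Tx x, w) = Ty (S.out (x, F x + N w))

theorem MorseRel.trans {N : W' ≃ₗ[ℝ] W} {N' : W'' ≃ₗ[ℝ] W'} {S : StateSys X W Y}
    {S' : StateSys X' W' Y'} {S'' : StateSys X'' W'' Y''} (h : MorseRel N S S')
    (h' : MorseRel N' S' S'') : MorseRel (N'.trans N) S S'' := by
  obtain ⟨Tx, Ty, F, K, h⟩ := h
  obtain ⟨Tx', Ty', F', K', h'⟩ := h'
  refine ⟨Tx.trans Tx', Ty.trans Ty', F + N.toLinearMap ∘ₗ F' ∘ₗ Tx.toLinearMap,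
    K + Tx.symm.toLinearMap ∘ₗ K' ∘ₗ Ty.toLinearMap, fun x w => ?_⟩
  have key : F x + N (F' (Tx x)) + N (N' w) = F x + N (F' (Tx x) + N' w) := by
    rw [map_add, add_assoc]
  simp only [LinearEquiv.trans_apply, LinearMap.add_apply, LinearMap.comp_apply,
    LinearEquiv.coe_coe, key]
  refine ⟨?_, ?_⟩
  · rw [(h' (Tx x) w).1, (h x _).1, (h x _).2]
    congr 1
    simp only [map_add, LinearEquiv.apply_symm_apply]
    abel
  · rw [(h' (Tx x) w).2, (h x _).2]

/-- Integrate every output and add `Q`-many independent direct feedthroughs. -/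
def ext (Q : Type) [AddCommGroup Q] [Module ℝ Q] (S : StateSys X W Y) :
    StateSys (Y × X) (W × Q) (Y × Q) where
  dyn := (S.out.prod S.dyn) ∘ₗ (LinearMap.snd ℝ Y X).prodMap (LinearMap.fst ℝ W Q)
  out := (LinearMap.fst ℝ Y X).prodMap (LinearMap.snd ℝ W Q)

@[simp] theorem ext_dyn (S : StateSys X W Y) (z : Y) (x : X) (w : W) (q : Q) :
    (S.ext Q).dyn ((z, x), (w, q)) = (S.out (x, w), S.dyn (x, w)) := rfl

@[simp] theorem ext_out (S : StateSys X W Y) (z : Y) (x : X) (w : W) (q : Q) :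
    (S.ext Q).out ((z, x), (w, q)) = (z, q) := rfl

theorem dyn_split (S : StateSys X W Y) (x x' : X) (w : W) :
    S.dyn (x + x', w) = S.dyn (x, w) + S.dyn (x', 0) := by
  rw [← map_add]; simp

theorem out_split (S : StateSys X W Y) (x x' : X) (w : W) :
    S.out (x + x', w) = S.out (x, w) + S.out (x', 0) := by
  rw [← map_add]; simp

/-- In the extension the old output is the derivative of the new state `z`, so injecting `K` times
it amounts to the state change `x ↦ x + K z`. The feedback must then be taken at `x + K z`, and the
discrepancy `S.dyn (K z, 0)`, `S.out (K z, 0)` is a function of the measured `z`, hence an output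
injection. -/
theorem MorseRel.ext {N : W' ≃ₗ[ℝ] W} {S : StateSys X W Y} {S' : StateSys X' W' Y'}
    (h : MorseRel N S S') :
    MorseRel (N.prodCongr (LinearEquiv.refl ℝ Q)) (S.ext Q) (S'.ext Q) := by
  obtain ⟨Tx, Ty, F, K, h⟩ := h
  refine ⟨Ty.skewProd Tx (Tx.toLinearMap ∘ₗ K), Ty.prodCongr (LinearEquiv.refl ℝ Q),
    LinearMap.inl ℝ W Q ∘ₗ F ∘ₗ (LinearMap.snd ℝ Y X + K ∘ₗ LinearMap.fst ℝ Y X),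
    (S.out.prod S.dyn) ∘ₗ LinearMap.inl ℝ X W ∘ₗ K ∘ₗ LinearMap.fst ℝ Y Q, ?_⟩
  rintro ⟨z, x⟩ ⟨w, q⟩
  have e : Tx x + Tx (K z) = Tx (x + K z) := (map_add _ _ _).symm
  simp only [LinearEquiv.skewProd_apply, LinearMap.comp_apply, LinearEquiv.coe_coe, e, ext_dyn,
    ext_out, (h _ _).1, (h _ _).2, LinearMap.add_apply, LinearMap.fst_apply, LinearMap.snd_apply,
    LinearMap.inl_apply, LinearEquiv.prodCongr_apply, Prod.mk_add_mk, LinearMap.prod_apply,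
    Function.prod, dyn_split, out_split, LinearEquiv.refl_apply, zero_add, Prod.mk.injEq, and_true]
  refine ⟨trivial, ?_⟩
  simp only [map_add]

/-- Add outputs that are identically zero. -/
def padOut (Y₀ : Type) [AddCommGroup Y₀] [Module ℝ Y₀] (S : StateSys X W Y) :
    StateSys X W (Y × Y₀) where
  dyn := S.dyn
  out := LinearMap.inl ℝ Y Y₀ ∘ₗ S.out

theorem MorseRel.padOut {N : W' ≃ₗ[ℝ] W} {S : StateSys X W Y} {S' : StateSys X' W' Y'}
    (h : MorseRel N S S') : MorseRel N (S.padOut Y₀) (S'.padOut Y₀) := by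
  obtain ⟨Tx, Ty, F, K, h⟩ := h
  refine ⟨Tx, Ty.prodCongr (LinearEquiv.refl ℝ Y₀), F, K ∘ₗ LinearMap.fst ℝ Y Y₀, fun x w => ?_⟩
  simp [StateSys.padOut, (h x w).1, (h x w).2]

/-- Independent chains of integrators. -/
def chainSys {κ : Type} (σ : κ → ℕ) : StateSys ((Σ i, Fin (σ i)) → ℝ) (κ → ℝ) (κ → ℝ) where
  dyn :=
    { toFun := fun p a => if h : (a.2 : ℕ) + 1 < σ a.1 then p.1 ⟨a.1, ⟨a.2 + 1, h⟩⟩ else p.2 a.1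
      map_add' := fun p q => by
        ext a
        by_cases h : (a.2 : ℕ) + 1 < σ a.1 <;> simp [h]
      map_smul' := fun c p => by
        ext a
        by_cases h : (a.2 : ℕ) + 1 < σ a.1 <;> simp [h] }
  out :=
    { toFun := fun p i => if h : 0 < σ i then p.1 ⟨i, ⟨0, h⟩⟩ else p.2 i
      map_add' := fun p q => by
        ext i
        by_cases h : 0 < σ i <;> simp [h]
      map_smul' := fun c p => by
        ext i
        by_cases h : 0 < σ i <;> simp [h] }

/-- The system is Morse equivalent to independent chains of integrators. -/
def Prime (S : StateSys X W Y) : Prop :=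
  ∃ (κ : Type) (_ : Fintype κ) (σ : κ → ℕ) (N : (κ → ℝ) ≃ₗ[ℝ] W), MorseRel N S (chainSys σ)

theorem Prime.of_morseRel {N : W' ≃ₗ[ℝ] W} {S : StateSys X W Y} {S' : StateSys X' W' Y'}
    (h : MorseRel N S S') (h' : S'.Prime) : S.Prime := by
  obtain ⟨κ, i, σ, N', h'⟩ := h'
  exact ⟨κ, i, σ, _, h.trans h'⟩

/-- Prepending a coordinate to each chain, and adding empty chains, on the level of states. -/
def consEquiv {κ ρ : Type} (σ : κ → ℕ) :
    ((κ → ℝ) × ((Σ i, Fin (σ i)) → ℝ)) ≃ₗ[ℝ]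
      ((Σ i : κ ⊕ ρ, Fin (Sum.elim (fun i => σ i + 1) (fun _ => 0) i)) → ℝ) where
  toFun p a := match a with
    | ⟨Sum.inl i, j⟩ => Fin.cases (motive := fun _ => ℝ) (p.1 i) (fun j => p.2 ⟨i, j⟩) j
    | ⟨Sum.inr _, j⟩ => j.elim0
  map_add' p q := by
    ext ⟨i | i, j⟩
    · refine Fin.cases ?_ (fun j => ?_) j <;> simp
    · exact j.elim0
  map_smul' c p := by
    ext ⟨i | i, j⟩
    · refine Fin.cases ?_ (fun j => ?_) j <;> simp
    · exact j.elim0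
  invFun y := (fun i => y ⟨Sum.inl i, (0 : Fin (σ i + 1))⟩,
    fun a => y ⟨Sum.inl a.1, (Fin.succ a.2 : Fin (σ a.1 + 1))⟩)
  left_inv p := by ext <;> simp
  right_inv y := by
    ext ⟨i | i, j⟩
    · refine Fin.cases ?_ (fun j => ?_) j <;> simp
    · exact j.elim0

/-- Each chain gains one integrator at its output end, and each coordinate of `Q` is a chain of
length 0. -/
theorem Prime.ext [FiniteDimensional ℝ Q] {S : StateSys X W Y} (h : S.Prime) :
    (S.ext Q).Prime := by
  obtain ⟨κ, _, σ, N, h⟩ := h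
  refine Prime.of_morseRel (MorseRel.ext (Q := Q) h) ?_
  let eQ : Q ≃ₗ[ℝ] (Fin (Module.finrank ℝ Q) → ℝ) := (Module.finBasis ℝ Q).equivFun
  let e : ((κ → ℝ) × Q) ≃ₗ[ℝ] (κ ⊕ Fin (Module.finrank ℝ Q) → ℝ) :=
    ((LinearEquiv.refl ℝ _).prodCongr eQ).trans
      (LinearEquiv.sumArrowLequivProdArrow κ (Fin (Module.finrank ℝ Q)) ℝ ℝ).symm
  refine ⟨κ ⊕ Fin (Module.finrank ℝ Q), inferInstance,
    Sum.elim (fun i => σ i + 1) (fun _ => 0), e.symm, consEquiv σ, e, 0, 0, ?_⟩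
  rintro ⟨z, x⟩ w
  obtain ⟨⟨w, q⟩, rfl⟩ := e.surjective w
  simp only [LinearMap.zero_apply, zero_add, LinearEquiv.symm_apply_apply, ext_dyn, ext_out,
    add_zero]
  constructor
  · ext ⟨i | i, j⟩
    · refine Fin.cases ?_ (fun j => ?_) j
      · change (if h : 0 + 1 < σ i + 1 then consEquiv σ (z, x) ⟨Sum.inl i, ⟨0 + 1, h⟩⟩
          else e (w, q) (Sum.inl i)) = if h : 0 < σ i then x ⟨i, ⟨0, h⟩⟩ else w i
        by_cases hi : 0 < σ i
        · rw [dif_pos (by omega), dif_pos hi]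
          rfl
        · rw [dif_neg (by omega), dif_neg hi]
          simp [e]
      · change (if h : (j : ℕ) + 1 + 1 < σ i + 1 then
          consEquiv σ (z, x) ⟨Sum.inl i, ⟨(j : ℕ) + 1 + 1, h⟩⟩ else e (w, q) (Sum.inl i)) =
          if h : (j : ℕ) + 1 < σ i then x ⟨i, ⟨(j : ℕ) + 1, h⟩⟩ else w i
        by_cases hj : (j : ℕ) + 1 < σ i
        · rw [dif_pos (by omega), dif_pos hj]
          rfl
        · rw [dif_neg (by omega), dif_neg hj]
          simp [e]
    · exact j.elim0
  · ext (i | i)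
    · simp [chainSys, e]
      rfl
    · simp [chainSys, e]

end StateSys

/-! ### Morse triangular forms and their stability under extension -/

/-- The blocks of a coordinate-free system in Morse triangular form. -/
structure TriForm (X₁ X₂ X₃ X₄ W₁ W₃ Y₃ Y₄ : Type)
    [AddCommGroup X₁] [Module ℝ X₁] [AddCommGroup X₂] [Module ℝ X₂]
    [AddCommGroup X₃] [Module ℝ X₃] [AddCommGroup X₄] [Module ℝ X₄]
    [AddCommGroup W₁] [Module ℝ W₁] [AddCommGroup W₃] [Module ℝ W₃]
    [AddCommGroup Y₃] [Module ℝ Y₃] [AddCommGroup Y₄] [Module ℝ Y₄] where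
  A₁ : X₁ →ₗ[ℝ] X₁
  B₁ : W₁ →ₗ[ℝ] X₁
  M : (X₂ × X₃ × X₄) × W₃ →ₗ[ℝ] X₁
  A₂ : X₂ →ₗ[ℝ] X₂
  A₂₄ : X₄ →ₗ[ℝ] X₂
  S₃ : StateSys X₃ W₃ Y₃
  A₃₄ : X₄ →ₗ[ℝ] X₃
  C₃₄ : X₄ →ₗ[ℝ] Y₃
  A₄ : X₄ →ₗ[ℝ] X₄
  C₄ : X₄ →ₗ[ℝ] Y₄

namespace TriForm

variable {X₁ X₂ X₃ X₄ W₁ W₃ Y₃ Y₄ Q Y₀ : Type}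
  [AddCommGroup X₁] [Module ℝ X₁] [AddCommGroup X₂] [Module ℝ X₂]
  [AddCommGroup X₃] [Module ℝ X₃] [AddCommGroup X₄] [Module ℝ X₄]
  [AddCommGroup W₁] [Module ℝ W₁] [AddCommGroup W₃] [Module ℝ W₃]
  [AddCommGroup Y₃] [Module ℝ Y₃] [AddCommGroup Y₄] [Module ℝ Y₄]
  [AddCommGroup Q] [Module ℝ Q] [AddCommGroup Y₀] [Module ℝ Y₀]

/-- The system assembled from the blocks. -/
def toSys (T : TriForm X₁ X₂ X₃ X₄ W₁ W₃ Y₃ Y₄) :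
    StateSys (X₁ × X₂ × X₃ × X₄) (W₁ × W₃) (Y₃ × Y₄) where
  dyn :=
    { toFun := fun p =>
        (T.A₁ p.1.1 + T.B₁ p.2.1 + T.M (p.1.2, p.2.2), T.A₂ p.1.2.1 + T.A₂₄ p.1.2.2.2,
          T.S₃.dyn (p.1.2.2.1, p.2.2) + T.A₃₄ p.1.2.2.2, T.A₄ p.1.2.2.2)
      map_add' := fun p q => by
        simp only [Prod.fst_add, Prod.snd_add, map_add, ← Prod.mk_add_mk]
        simp only [Prod.mk_add_mk, Prod.mk.injEq]
        exact ⟨by abel, by abel, by abel, trivial⟩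
      map_smul' := fun c p => by
        simp only [Prod.smul_fst, Prod.smul_snd, ← Prod.smul_mk, map_smul, RingHom.id_apply,
          ← smul_add] }
  out :=
    { toFun := fun p => (T.S₃.out (p.1.2.2.1, p.2.2) + T.C₃₄ p.1.2.2.2, T.C₄ p.1.2.2.2)
      map_add' := fun p q => by
        simp only [Prod.fst_add, Prod.snd_add, map_add, ← Prod.mk_add_mk]
        simp only [Prod.mk_add_mk, Prod.mk.injEq]
        exact ⟨by abel, trivial⟩
      map_smul' := fun c p => by
        simp only [Prod.smul_fst, Prod.smul_snd, ← Prod.smul_mk, map_smul, RingHom.id_apply,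
          ← smul_add] }

theorem toSys_dyn (T : TriForm X₁ X₂ X₃ X₄ W₁ W₃ Y₃ Y₄) (x₁ x₂ x₃ x₄ w₁ w₃) :
    T.toSys.dyn ((x₁, x₂, x₃, x₄), (w₁, w₃)) =
      (T.A₁ x₁ + T.B₁ w₁ + T.M ((x₂, x₃, x₄), w₃), T.A₂ x₂ + T.A₂₄ x₄,
        T.S₃.dyn (x₃, w₃) + T.A₃₄ x₄, T.A₄ x₄) := rfl

theorem toSys_out (T : TriForm X₁ X₂ X₃ X₄ W₁ W₃ Y₃ Y₄) (x₁ x₂ x₃ x₄ w₁ w₃) :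
    T.toSys.out ((x₁, x₂, x₃, x₄), (w₁, w₃)) = (T.S₃.out (x₃, w₃) + T.C₃₄ x₄, T.C₄ x₄) := rfl

/-- Block 1 is controllable, block 4 is observable and block 3 is prime. -/
structure Good (T : TriForm X₁ X₂ X₃ X₄ W₁ W₃ Y₃ Y₄) : Prop where
  controllable : ∀ P : Submodule ℝ X₁, (∀ w, T.B₁ w ∈ P) → (∀ x ∈ P, T.A₁ x ∈ P) → P = ⊤
  observable : ∀ P : Submodule ℝ X₄, (∀ x ∈ P, T.C₄ x = 0) → (∀ x ∈ P, T.A₄ x ∈ P) → P = ⊥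
  prime : T.S₃.Prime

/-- The triangular form of the system with integrated outputs and added feedthroughs. -/
def ext (Q : Type) [AddCommGroup Q] [Module ℝ Q] (T : TriForm X₁ X₂ X₃ X₄ W₁ W₃ Y₃ Y₄) :
    TriForm X₁ X₂ (Y₃ × X₃) (Y₄ × X₄) W₁ (W₃ × Q) (Y₃ × Q) Y₄ where
  A₁ := T.A₁
  B₁ := T.B₁
  M := T.M ∘ₗ ((LinearMap.id.prodMap ((LinearMap.snd ℝ Y₃ X₃).prodMap
    (LinearMap.snd ℝ Y₄ X₄))).prodMap (LinearMap.fst ℝ W₃ Q))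
  A₂ := T.A₂
  A₂₄ := T.A₂₄ ∘ₗ LinearMap.snd ℝ Y₄ X₄
  S₃ := T.S₃.ext Q
  A₃₄ := (T.C₃₄.prod T.A₃₄) ∘ₗ LinearMap.snd ℝ Y₄ X₄
  C₃₄ := 0
  A₄ := (T.C₄.prod T.A₄) ∘ₗ LinearMap.snd ℝ Y₄ X₄
  C₄ := LinearMap.fst ℝ Y₄ X₄

/-- For observability, an invariant subspace on which the integrated output vanishes also has
vanishing derivative of that output. Its projection to `X₄` is therefore invariant and killed by the
old `C₄`, hence zero. -/
theorem Good.ext [FiniteDimensional ℝ Q] {T : TriForm X₁ X₂ X₃ X₄ W₁ W₃ Y₃ Y₄} (h : T.Good) :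
    (T.ext Q).Good where
  controllable := h.controllable
  observable P hC hA := by
    have key := h.observable (P.map (LinearMap.snd ℝ Y₄ X₄))
    have hP : P.map (LinearMap.snd ℝ Y₄ X₄) = ⊥ := by
      apply key
      · rintro _ ⟨x, hx, rfl⟩
        exact hC _ (hA x hx)
      · rintro _ ⟨x, hx, rfl⟩
        exact ⟨_, hA x hx, rfl⟩
    rw [eq_bot_iff]
    intro x hx
    have h1 : x.1 = 0 := hC x hx
    have h2 : x.2 ∈ P.map (LinearMap.snd ℝ Y₄ X₄) := ⟨x, hx, rfl⟩
    rw [hP, Submodule.mem_bot] at h2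
    exact Prod.ext h1 h2
  prime := h.prime.ext

/-- A mere regrouping of coordinates: the integrators of `Y₃` join block 3, those of `Y₄` join block
4, and the direct channels join the outputs and inputs of block 3. -/
theorem exists_morseRel_ext (T : TriForm X₁ X₂ X₃ X₄ W₁ W₃ Y₃ Y₄) :
    ∃ N, StateSys.MorseRel N (T.toSys.ext Q) (T.ext Q).toSys := by
  let Tx : ((Y₃ × Y₄) × X₁ × X₂ × X₃ × X₄) ≃ₗ[ℝ] (X₁ × X₂ × (Y₃ × X₃) × (Y₄ × X₄)) :=
    { toFun := fun p => (p.2.1, p.2.2.1, (p.1.1, p.2.2.2.1), (p.1.2, p.2.2.2.2))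
      map_add' := fun _ _ => rfl
      map_smul' := fun _ _ => rfl
      invFun := fun p => ((p.2.2.1.1, p.2.2.2.1), p.1, p.2.1, p.2.2.1.2, p.2.2.2.2)
      left_inv := fun _ => rfl
      right_inv := fun _ => rfl }
  let Ty : ((Y₃ × Y₄) × Q) ≃ₗ[ℝ] ((Y₃ × Q) × Y₄) :=
    { toFun := fun p => ((p.1.1, p.2), p.1.2)
      map_add' := fun _ _ => rfl
      map_smul' := fun _ _ => rfl
      invFun := fun p => ((p.1.1, p.2), p.1.2)
      left_inv := fun _ => rfl
      right_inv := fun _ => rfl }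
  refine ⟨(LinearEquiv.prodAssoc ℝ W₁ W₃ Q).symm, Tx, Ty, 0, 0, ?_⟩
  rintro ⟨⟨z₃, z₄⟩, x₁, x₂, x₃, x₄⟩ ⟨w₁, w₃, q⟩
  simp only [LinearMap.zero_apply, zero_add, add_zero]
  refine ⟨rfl, ?_⟩
  change ((z₃, q) + 0, z₄) = _
  rw [add_zero]
  rfl

/-- The triangular form of the system with added zero outputs. -/
def padOut (Y₀ : Type) [AddCommGroup Y₀] [Module ℝ Y₀] (T : TriForm X₁ X₂ X₃ X₄ W₁ W₃ Y₃ Y₄) :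
    TriForm X₁ X₂ X₃ X₄ W₁ W₃ Y₃ (Y₄ × Y₀) :=
  { T with C₄ := LinearMap.inl ℝ Y₄ Y₀ ∘ₗ T.C₄ }

theorem Good.padOut {T : TriForm X₁ X₂ X₃ X₄ W₁ W₃ Y₃ Y₄} (h : T.Good) :
    (T.padOut Y₀).Good where
  controllable := h.controllable
  observable P hC hA := h.observable P (fun x hx => congrArg Prod.fst (hC x hx)) hA
  prime := h.prime

theorem morseRel_padOut (T : TriForm X₁ X₂ X₃ X₄ W₁ W₃ Y₃ Y₄) :
    StateSys.MorseRel (LinearEquiv.refl ℝ _) (T.toSys.padOut Y₀) (T.padOut Y₀).toSys := by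
  refine ⟨LinearEquiv.refl ℝ _, LinearEquiv.prodAssoc ℝ Y₃ Y₄ Y₀, 0, 0, ?_⟩
  rintro ⟨x₁, x₂, x₃, x₄⟩ ⟨w₁, w₃⟩
  simp only [LinearMap.zero_apply, zero_add, add_zero]
  exact ⟨rfl, rfl⟩

end TriForm

/-! ### Triangularizable systems and the case without outputs -/

namespace StateSys

variable {X W Y X' W' Y' Q Y₀ : Type}
  [AddCommGroup X] [Module ℝ X] [AddCommGroup W] [Module ℝ W] [AddCommGroup Y] [Module ℝ Y]
  [AddCommGroup X'] [Module ℝ X'] [AddCommGroup W'] [Module ℝ W'] [AddCommGroup Y'] [Module ℝ Y']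
  [AddCommGroup Q] [Module ℝ Q] [AddCommGroup Y₀] [Module ℝ Y₀]

/-- The system is Morse equivalent to a system in Morse triangular form. -/
inductive Triangularizable (S : StateSys X W Y) : Prop
  | intro {X₁ X₂ X₃ X₄ W₁ W₃ Y₃ Y₄ : Type}
    [AddCommGroup X₁] [Module ℝ X₁] [AddCommGroup X₂] [Module ℝ X₂]
    [AddCommGroup X₃] [Module ℝ X₃] [AddCommGroup X₄] [Module ℝ X₄]
    [AddCommGroup W₁] [Module ℝ W₁] [AddCommGroup W₃] [Module ℝ W₃]
    [AddCommGroup Y₃] [Module ℝ Y₃] [AddCommGroup Y₄] [Module ℝ Y₄]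
    (T : TriForm X₁ X₂ X₃ X₄ W₁ W₃ Y₃ Y₄) (N : (W₁ × W₃) ≃ₗ[ℝ] W)
    (rel : MorseRel N S T.toSys) (good : T.Good) : Triangularizable S

theorem Triangularizable.of_morseRel {N : W' ≃ₗ[ℝ] W} {S : StateSys X W Y}
    {S' : StateSys X' W' Y'} (h : MorseRel N S S') (h' : S'.Triangularizable) :
    S.Triangularizable := by
  obtain ⟨T, N', rel, good⟩ := h'
  exact ⟨T, _, h.trans rel, good⟩

theorem Triangularizable.ext [FiniteDimensional ℝ Q] {S : StateSys X W Y}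
    (h : S.Triangularizable) : (S.ext Q).Triangularizable := by
  obtain ⟨T, N, rel, good⟩ := h
  obtain ⟨N', h'⟩ := T.exists_morseRel_ext (Q := Q)
  exact ⟨T.ext Q, _, rel.ext.trans h', good.ext⟩

theorem Triangularizable.padOut {S : StateSys X W Y} (h : S.Triangularizable) :
    (S.padOut Y₀).Triangularizable := by
  obtain ⟨T, N, rel, good⟩ := h
  exact ⟨T.padOut Y₀, _, rel.padOut.trans T.morseRel_padOut, good.padOut⟩

/-- Kalman decomposition of a system without outputs. -/
theorem triangularizable_of_subsingleton [Subsingleton Y] (S : StateSys X W Y) :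
    S.Triangularizable := by
  let A : X →ₗ[ℝ] X := S.dyn ∘ₗ LinearMap.inl ℝ X W
  let B : W →ₗ[ℝ] X := S.dyn ∘ₗ LinearMap.inr ℝ X W
  -- The reachable subspace, as the smallest invariant subspace containing the image of `B`;
  -- minimality will give controllability of block 1 directly.
  let P : Submodule ℝ X := sInf {P | (∀ w, B w ∈ P) ∧ ∀ x ∈ P, A x ∈ P}
  have hB : ∀ w, B w ∈ P := fun w => by
    rw [Submodule.mem_sInf]
    exact fun P' h => h.1 w
  have hA : ∀ x ∈ P, A x ∈ P := fun x hx => by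
    rw [Submodule.mem_sInf] at hx ⊢
    exact fun P' h => h.2 x (hx P' h)
  obtain ⟨P', hP⟩ := Submodule.exists_isCompl P
  let e : (P × P') ≃ₗ[ℝ] X := Submodule.prodEquivOfIsCompl P P' hP
  let T : TriForm P P' PUnit PUnit W PUnit PUnit PUnit :=
    { A₁ := A.restrict hA
      B₁ := B.codRestrict P hB
      M := LinearMap.fst ℝ P P' ∘ₗ e.symm.toLinearMap ∘ₗ A ∘ₗ P'.subtype ∘ₗ
        LinearMap.fst ℝ P' _ ∘ₗ LinearMap.fst ℝ _ _
      A₂ := LinearMap.snd ℝ P P' ∘ₗ e.symm.toLinearMap ∘ₗ A ∘ₗ P'.subtype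
      A₂₄ := 0
      S₃ := ⟨0, 0⟩
      A₃₄ := 0
      C₃₄ := 0
      A₄ := 0
      C₄ := 0 }
  let _ : Unique (PUnit.{1} × PUnit.{1}) := Unique.mk' _
  let Tx : X ≃ₗ[ℝ] (P × P' × PUnit × PUnit) :=
    e.symm.trans ((LinearEquiv.refl ℝ P).prodCongr LinearEquiv.prodUnique.symm)
  let Ty : Y ≃ₗ[ℝ] (PUnit.{1} × PUnit.{1}) :=
    LinearEquiv.ofSubsingleton Y (PUnit.{1} × PUnit.{1})
  refine ⟨T, LinearEquiv.prodUnique, ⟨Tx, Ty, 0, 0, ?_⟩, ⟨?_, ?_, ?_⟩⟩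
  · intro x w
    obtain ⟨⟨a, b⟩, rfl⟩ := e.surjective x
    obtain ⟨w, ⟨⟩⟩ := w
    refine ⟨?_, Subsingleton.elim _ _⟩
    have h1 : S.dyn (e (a, b), w) = A a + A b + B w := by
      simp only [A, B, LinearMap.comp_apply, ← map_add]
      simp [e]
    have h2 : e.symm (A a) = (⟨A a, hA a a.2⟩, 0) := by
      rw [LinearEquiv.symm_apply_eq]; simp [e]
    have h3 : e.symm (B w) = (⟨B w, hB w⟩, 0) := by
      rw [LinearEquiv.symm_apply_eq]; simp [e]
    have h4 : Tx (e (a, b)) = (a, b, 0, 0) := by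
      simp [Tx]
    simp only [LinearMap.zero_apply, zero_add, add_zero, h4, LinearEquiv.prodUnique_apply, h1]
    simp only [Tx, LinearEquiv.trans_apply, map_add, h2, h3]
    rw [T.toSys_dyn]
    ext
    · simp [T]
      abel
    · simp [T]
  · intro R h1 h2
    have key : P ≤ R.map P.subtype := by
      refine sInf_le ⟨fun w => ⟨_, h1 w, rfl⟩, ?_⟩
      rintro _ ⟨x, hx, rfl⟩
      exact ⟨_, h2 x hx, rfl⟩
    rw [eq_top_iff]
    intro x _
    obtain ⟨y, hy, hxy⟩ := key x.2
    rwa [Subtype.ext hxy] at hy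
  · exact fun R _ _ => Subsingleton.elim _ _
  -- Block 3 is zero, hence prime with no chains at all.
  · refine ⟨Fin 0, inferInstance, fun _ => 0, LinearEquiv.ofSubsingleton _ _,
      LinearEquiv.ofSubsingleton _ _, LinearEquiv.ofSubsingleton _ _, 0, 0, fun x w => ?_⟩
    exact ⟨funext fun a => a.1.elim0, Subsingleton.elim _ _⟩

/-- Rank normal form of a linear map. -/
theorem exists_rank_normalForm (h : X →ₗ[ℝ] Y) :
    ∃ (R : Submodule ℝ Y) (eX : (LinearMap.ker h × LinearMap.range h) ≃ₗ[ℝ] X)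
      (eY : Y ≃ₗ[ℝ] (LinearMap.range h × R)), ∀ a q, eY (h (eX (a, q))) = (q, 0) := by
  obtain ⟨R, hR⟩ := Submodule.exists_isCompl (LinearMap.range h)
  obtain ⟨L, hL⟩ := Submodule.exists_isCompl (LinearMap.ker h)
  let q : L ≃ₗ[ℝ] LinearMap.range h :=
    (Submodule.quotientEquivOfIsCompl _ L hL).symm.trans h.quotKerEquivRange
  let eX : (LinearMap.ker h × LinearMap.range h) ≃ₗ[ℝ] X :=
    ((LinearEquiv.refl ℝ _).prodCongr q.symm).trans (Submodule.prodEquivOfIsCompl _ L hL)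
  refine ⟨R, eX, (Submodule.prodEquivOfIsCompl _ R hR).symm, fun a y => ?_⟩
  obtain ⟨l, rfl⟩ := q.surjective y
  rw [LinearEquiv.symm_apply_eq]
  simp [eX, q]

end StateSys

/-! ### Peeling off one layer of integrators, and the induction -/

namespace StateSys

variable {X W Y : Type}
  [AddCommGroup X] [Module ℝ X] [AddCommGroup W] [Module ℝ W] [AddCommGroup Y] [Module ℝ Y]

/-- Splitting off the feedthrough, the zero outputs and one integrator behind each other output. -/
theorem exists_morseRel_padOut_ext (S : StateSys X W Y) :
    ∃ (R : Submodule ℝ Y) (C : X →ₗ[ℝ] R) (R₀ : Submodule ℝ R) (D : W →ₗ[ℝ] Y)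
      (S₁ : StateSys (LinearMap.ker C) (LinearMap.ker D) (LinearMap.range C))
      (N : (LinearMap.ker D × LinearMap.range D) ≃ₗ[ℝ] W),
      MorseRel N S ((S₁.ext (LinearMap.range D)).padOut R₀) := by
  let D : W →ₗ[ℝ] Y := S.out ∘ₗ LinearMap.inr ℝ X W
  obtain ⟨R, eW, eY, hD⟩ := exists_rank_normalForm D
  let E : X →ₗ[ℝ] (LinearMap.range D × R) := eY.toLinearMap ∘ₗ S.out ∘ₗ LinearMap.inl ℝ X W
  let c : X →ₗ[ℝ] LinearMap.range D := LinearMap.fst ℝ _ _ ∘ₗ E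
  let C : X →ₗ[ℝ] R := LinearMap.snd ℝ _ _ ∘ₗ E
  obtain ⟨R₀, eX, eR, hC⟩ := exists_rank_normalForm C
  -- This feedback cancels `c x`, the state's contribution to the output inside the range of `D`.
  let F : X →ₗ[ℝ] W := -(eW.toLinearMap ∘ₗ LinearMap.inr ℝ _ _ ∘ₗ c)
  have hout : ∀ x k q, eY (S.out (x, F x + eW (k, q))) = (q, C x) := by
    intro x k q
    have h1 : F x + eW (k, q) = eW (k, q - c x) := by
      simp only [F, LinearMap.neg_apply, LinearMap.comp_apply, LinearMap.inr_apply,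
        LinearEquiv.coe_coe, ← map_neg, ← map_add]
      congr 1
      ext <;> simp [sub_eq_neg_add]
    have h2 : S.out (x, eW (k, q - c x)) = S.out (x, 0) + D (eW (k, q - c x)) := by
      simp only [D, LinearMap.comp_apply, LinearMap.inr_apply, ← map_add]
      simp
    rw [h1, h2, map_add, hD]
    ext
    · simp [c, E]
    · simp [C, E]
  -- `G` collects what the measured quantities `z` and `q` contribute to the closed-loop dynamics,
  -- to be removed by output injection; `H` is what the unmeasured state and the remaining inputs
  -- contribute.
  let G : (LinearMap.range C × LinearMap.range D) →ₗ[ℝ] X :=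
    S.dyn ∘ₗ (LinearMap.id.prod F).coprod
      (LinearMap.inr ℝ X W ∘ₗ eW.toLinearMap ∘ₗ LinearMap.inr ℝ _ _) ∘ₗ
      ((eX.toLinearMap ∘ₗ LinearMap.inr ℝ _ _).prodMap LinearMap.id)
  let H : (LinearMap.ker C × LinearMap.ker D) →ₗ[ℝ] (LinearMap.ker C × LinearMap.range C) :=
    eX.symm.toLinearMap ∘ₗ S.dyn ∘ₗ (LinearMap.id.prod F).coprod
      (LinearMap.inr ℝ X W ∘ₗ eW.toLinearMap ∘ₗ LinearMap.inl ℝ _ _) ∘ₗ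
      ((eX.toLinearMap ∘ₗ LinearMap.inl ℝ _ _).prodMap LinearMap.id)
  let Ty : Y ≃ₗ[ℝ] ((LinearMap.range C × LinearMap.range D) × R₀) :=
    eY.trans (((LinearEquiv.refl ℝ _).prodCongr eR).trans
      ((LinearEquiv.prodAssoc ℝ _ _ _).symm.trans
        ((LinearEquiv.prodComm ℝ _ _).prodCongr (LinearEquiv.refl ℝ _))))
  refine ⟨R, C, R₀, D, ⟨LinearMap.fst ℝ _ _ ∘ₗ H, LinearMap.snd ℝ _ _ ∘ₗ H⟩, eW,
    eX.symm.trans (LinearEquiv.prodComm ℝ _ _), Ty, F,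
    -(G ∘ₗ LinearMap.fst ℝ _ _ ∘ₗ Ty.toLinearMap), fun x w => ?_⟩
  obtain ⟨⟨a, z⟩, rfl⟩ := eX.surjective x
  obtain ⟨k, q⟩ := w
  have hTy : Ty (S.out (eX (a, z), F (eX (a, z)) + eW (k, q))) = ((z, q), 0) := by
    simp only [Ty, LinearEquiv.trans_apply, hout, LinearEquiv.prodCongr_apply, hC]
    rfl
  have hdyn : S.dyn (eX (a, z), F (eX (a, z)) + eW (k, q)) - G (z, q) = eX (H (a, k)) := by
    simp only [G, H, LinearMap.comp_apply, LinearEquiv.coe_coe, LinearEquiv.apply_symm_apply,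
      ← map_sub]
    congr 1
    have h1 : eX (a, z) = eX (a, 0) + eX (0, z) := by rw [← map_add]; simp
    have h2 : eW (k, q) = eW (k, 0) + eW (0, q) := by rw [← map_add]; simp
    rw [h1, h2]
    ext <;> simp
    abel
  have hsum : S.dyn (eX (a, z), F (eX (a, z)) + eW (k, q)) +
      (-(G ∘ₗ LinearMap.fst ℝ _ _ ∘ₗ Ty.toLinearMap))
        (S.out (eX (a, z), F (eX (a, z)) + eW (k, q))) = eX (H (a, k)) := by
    rw [← hdyn, sub_eq_add_neg]
    simp only [LinearMap.neg_apply, LinearMap.comp_apply, LinearEquiv.coe_coe, hTy,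
      LinearMap.fst_apply]
  rw [hsum, hTy]
  simp only [padOut, LinearEquiv.trans_apply, LinearEquiv.symm_apply_apply]
  exact ⟨rfl, rfl⟩

/-- Every system is Morse equivalent to one in Morse triangular form. -/
theorem triangularizable_of_finrank_eq (n : ℕ) : ∀ {X W Y : Type} [AddCommGroup X] [Module ℝ X]
    [AddCommGroup W] [Module ℝ W] [AddCommGroup Y] [Module ℝ Y] [FiniteDimensional ℝ X]
    [FiniteDimensional ℝ Y] (S : StateSys X W Y), Module.finrank ℝ X = n →
    S.Triangularizable := by
  induction n using Nat.strong_induction_on with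
  | _ n ih =>
    intro X W Y _ _ _ _ _ _ _ _ S hn
    obtain ⟨R, C, R₀, D, S₁, N, h⟩ := S.exists_morseRel_padOut_ext
    refine Triangularizable.of_morseRel h (Triangularizable.padOut (Triangularizable.ext ?_))
    -- The state dimension drops exactly when `C ≠ 0`; otherwise the residual output space `range C`
    -- is trivial.
    rcases eq_or_ne C 0 with rfl | hC
    · have : Subsingleton (LinearMap.range (0 : X →ₗ[ℝ] R)) := by
        rw [LinearMap.range_zero]
        infer_instance
      exact triangularizable_of_subsingleton S₁
    · refine ih _ ?_ S₁ rfl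
      rw [← hn]
      apply Submodule.finrank_lt
      rwa [Ne, LinearMap.ker_eq_top]

theorem triangularizable [FiniteDimensional ℝ X] [FiniteDimensional ℝ Y] (S : StateSys X W Y) :
    S.Triangularizable :=
  triangularizable_of_finrank_eq _ S rfl

end StateSys

/-! ### Changes of coordinates within a triangular form -/

namespace TriForm

variable {X₁ X₂ X₃ X₄ W₁ W₃ Y₃ Y₄ X₁' X₂' X₃' X₄' W₁' W₃' Y₃' Y₄' : Type}
  [AddCommGroup X₁] [Module ℝ X₁] [AddCommGroup X₂] [Module ℝ X₂]
  [AddCommGroup X₃] [Module ℝ X₃] [AddCommGroup X₄] [Module ℝ X₄]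
  [AddCommGroup W₁] [Module ℝ W₁] [AddCommGroup W₃] [Module ℝ W₃]
  [AddCommGroup Y₃] [Module ℝ Y₃] [AddCommGroup Y₄] [Module ℝ Y₄]
  [AddCommGroup X₁'] [Module ℝ X₁'] [AddCommGroup X₂'] [Module ℝ X₂']
  [AddCommGroup X₃'] [Module ℝ X₃'] [AddCommGroup X₄'] [Module ℝ X₄']
  [AddCommGroup W₁'] [Module ℝ W₁'] [AddCommGroup W₃'] [Module ℝ W₃']
  [AddCommGroup Y₃'] [Module ℝ Y₃'] [AddCommGroup Y₄'] [Module ℝ Y₄']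

/-- Change of coordinates in each block, together with the change `w₁ = α w₁' + β w₃'`,
`w₃ = γ w₃'` of inputs. -/
def transport (T : TriForm X₁ X₂ X₃ X₄ W₁ W₃ Y₃ Y₄) (e₁ : X₁ ≃ₗ[ℝ] X₁') (e₂ : X₂ ≃ₗ[ℝ] X₂')
    (e₃ : X₃ ≃ₗ[ℝ] X₃') (e₄ : X₄ ≃ₗ[ℝ] X₄') (f₃ : Y₃ ≃ₗ[ℝ] Y₃') (f₄ : Y₄ ≃ₗ[ℝ] Y₄')
    (α : W₁' ≃ₗ[ℝ] W₁) (β : W₃' →ₗ[ℝ] W₁) (γ : W₃' ≃ₗ[ℝ] W₃) :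
    TriForm X₁' X₂' X₃' X₄' W₁' W₃' Y₃' Y₄' where
  A₁ := e₁.toLinearMap ∘ₗ T.A₁ ∘ₗ e₁.symm.toLinearMap
  B₁ := e₁.toLinearMap ∘ₗ T.B₁ ∘ₗ α.toLinearMap
  M := e₁.toLinearMap ∘ₗ (T.M ∘ₗ ((e₂.symm.toLinearMap.prodMap
    (e₃.symm.toLinearMap.prodMap e₄.symm.toLinearMap)).prodMap γ.toLinearMap) +
      T.B₁ ∘ₗ β ∘ₗ LinearMap.snd ℝ _ _)
  A₂ := e₂.toLinearMap ∘ₗ T.A₂ ∘ₗ e₂.symm.toLinearMap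
  A₂₄ := e₂.toLinearMap ∘ₗ T.A₂₄ ∘ₗ e₄.symm.toLinearMap
  S₃ := ⟨e₃.toLinearMap ∘ₗ T.S₃.dyn ∘ₗ (e₃.symm.toLinearMap.prodMap γ.toLinearMap),
    f₃.toLinearMap ∘ₗ T.S₃.out ∘ₗ (e₃.symm.toLinearMap.prodMap γ.toLinearMap)⟩
  A₃₄ := e₃.toLinearMap ∘ₗ T.A₃₄ ∘ₗ e₄.symm.toLinearMap
  C₃₄ := f₃.toLinearMap ∘ₗ T.C₃₄ ∘ₗ e₄.symm.toLinearMap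
  A₄ := e₄.toLinearMap ∘ₗ T.A₄ ∘ₗ e₄.symm.toLinearMap
  C₄ := f₄.toLinearMap ∘ₗ T.C₄ ∘ₗ e₄.symm.toLinearMap

variable (T : TriForm X₁ X₂ X₃ X₄ W₁ W₃ Y₃ Y₄) (e₁ : X₁ ≃ₗ[ℝ] X₁') (e₂ : X₂ ≃ₗ[ℝ] X₂')
    (e₃ : X₃ ≃ₗ[ℝ] X₃') (e₄ : X₄ ≃ₗ[ℝ] X₄') (f₃ : Y₃ ≃ₗ[ℝ] Y₃') (f₄ : Y₄ ≃ₗ[ℝ] Y₄')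
    (α : W₁' ≃ₗ[ℝ] W₁) (β : W₃' →ₗ[ℝ] W₁) (γ : W₃' ≃ₗ[ℝ] W₃)

/-- The cross term `β` sends inputs of block 3 only into the first row, where `M` is unconstrained.
-/
theorem morseRel_transport (N : (W₁' × W₃') ≃ₗ[ℝ] (W₁ × W₃))
    (hN : ∀ a b, N (a, b) = (α a + β b, γ b)) :
    StateSys.MorseRel N T.toSys (T.transport e₁ e₂ e₃ e₄ f₃ f₄ α β γ).toSys := by
  refine ⟨e₁.prodCongr (e₂.prodCongr (e₃.prodCongr e₄)), f₃.prodCongr f₄, 0, 0, ?_⟩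
  rintro ⟨x₁, x₂, x₃, x₄⟩ ⟨a, b⟩
  simp only [LinearMap.zero_apply, zero_add, add_zero, hN, toSys_dyn, toSys_out,
    LinearEquiv.prodCongr_apply, transport, LinearMap.comp_apply, LinearMap.add_apply,
    LinearEquiv.coe_coe, LinearMap.prodMap_apply, LinearEquiv.symm_apply_apply, map_add,
    LinearMap.snd_apply, Prod.mk.injEq, and_true]
  abel

theorem Good.transport {T : TriForm X₁ X₂ X₃ X₄ W₁ W₃ Y₃ Y₄} (h : T.Good) :
    (T.transport e₁ e₂ e₃ e₄ f₃ f₄ α β γ).Good where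
  controllable P hB hA := by
    have := h.controllable (P.comap e₁.toLinearMap) (fun w => ?_) (fun x hx => ?_)
    · rw [eq_top_iff]
      intro x _
      have hx : e₁.symm x ∈ P.comap e₁.toLinearMap := this ▸ Submodule.mem_top
      simpa using hx
    · simpa [TriForm.transport] using hB (α.symm w)
    · simpa [TriForm.transport] using hA (e₁ x) hx
  observable P hC hA := by
    have := h.observable (P.comap e₄.toLinearMap) (fun x hx => ?_) (fun x hx => ?_)
    · rw [eq_bot_iff]
      intro x hx
      have hx : e₄.symm x ∈ P.comap e₄.toLinearMap := by simpa using hx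
      rw [this] at hx
      simpa using hx
    · simpa [TriForm.transport] using hC (e₄ x) hx
    · simpa [TriForm.transport] using hA (e₄ x) hx
  prime := by
    refine StateSys.Prime.of_morseRel (N := γ.symm) ⟨e₃.symm, f₃.symm, 0, 0, fun x w => ?_⟩ h.prime
    simp [TriForm.transport]

end TriForm

/-! ### Subspaces of a product and input changes adapted to `(u, v)` -/

section Flag

variable {U V W₁ W₃ W₁' W₃' : Type} [AddCommGroup U] [Module ℝ U] [AddCommGroup V] [Module ℝ V]
  [AddCommGroup W₁] [Module ℝ W₁] [AddCommGroup W₃] [Module ℝ W₃]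
  [AddCommGroup W₁'] [Module ℝ W₁'] [AddCommGroup W₃'] [Module ℝ W₃']

/-- Coordinates of `V` in which a given subspace is spanned by the first coordinates. -/
theorem Submodule.exists_adapted_equiv [FiniteDimensional ℝ V] (P : Submodule ℝ V) :
    ∃ (a b : ℕ) (e : ((Fin a → ℝ) × (Fin b → ℝ)) ≃ₗ[ℝ] V), ∀ x y, e (x, y) ∈ P ↔ y = 0 := by
  obtain ⟨P', hP⟩ := Submodule.exists_isCompl P
  refine ⟨_, _, ((Module.finBasis ℝ P).equivFun.symm.prodCongr
    (Module.finBasis ℝ P').equivFun.symm).trans (Submodule.prodEquivOfIsCompl P P' hP),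
    fun x y => ?_⟩
  rw [LinearEquiv.trans_apply, LinearEquiv.prodCongr_apply,
    ← Submodule.prodEquivOfIsCompl_symm_apply_snd_eq_zero P P' hP, LinearEquiv.symm_apply_apply]
  exact LinearEquiv.map_eq_zero_iff _

/-- Triangular coordinates of `U × V` in which a given subspace is spanned by coordinates. -/
theorem Submodule.exists_adapted_prod [FiniteDimensional ℝ U] [FiniteDimensional ℝ V]
    (P : Submodule ℝ (U × V)) :
    ∃ (m₁ m₃ s₁ s₃ : ℕ) (eU : ((Fin m₁ → ℝ) × (Fin m₃ → ℝ)) ≃ₗ[ℝ] U)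
      (eV : ((Fin s₁ → ℝ) × (Fin s₃ → ℝ)) ≃ₗ[ℝ] V) (R : U →ₗ[ℝ] V),
      ∀ u₁ u₃ v₁ v₃, (eU (u₁, u₃), R (eU (u₁, u₃)) + eV (v₁, v₃)) ∈ P ↔ u₃ = 0 ∧ v₃ = 0 := by
  -- The first coordinates of `V` span `P ∩ V`, those of `U` span the projection of `P` to `U`; `R`
  -- extends the `V`-component of a linear section of that projection.
  obtain ⟨s₁, s₃, eV, hV⟩ := (P.comap (LinearMap.inr ℝ U V)).exists_adapted_equiv
  obtain ⟨m₁, m₃, eU, hU⟩ := (P.map (LinearMap.fst ℝ U V)).exists_adapted_equiv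
  let π : P →ₗ[ℝ] P.map (LinearMap.fst ℝ U V) := (LinearMap.fst ℝ U V).submoduleMap P
  obtain ⟨σ, hσ⟩ := π.exists_rightInverse_of_surjective
    (LinearMap.range_eq_top.2 ((LinearMap.fst ℝ U V).submoduleMap_surjective P))
  obtain ⟨R, hR⟩ := (LinearMap.snd ℝ U V ∘ₗ P.subtype ∘ₗ σ).exists_extend
  have key : ∀ u ∈ P.map (LinearMap.fst ℝ U V), (u, R u) ∈ P := by
    intro u hu
    have h1 : R u = (σ ⟨u, hu⟩ : U × V).2 := LinearMap.congr_fun hR ⟨u, hu⟩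
    have h2 : (σ ⟨u, hu⟩ : U × V).1 = u :=
      congrArg Subtype.val (LinearMap.congr_fun hσ ⟨u, hu⟩)
    have h3 : (u, R u) = (σ ⟨u, hu⟩ : U × V) := Prod.ext h2.symm h1
    rw [h3]
    exact (σ ⟨u, hu⟩).2
  refine ⟨m₁, m₃, s₁, s₃, eU, eV, R, fun u₁ u₃ v₁ v₃ => ?_⟩
  rw [← hU u₁ u₃, ← hV v₁ v₃, Submodule.mem_comap, LinearMap.inr_apply]
  have split : (eU (u₁, u₃), R (eU (u₁, u₃)) + eV (v₁, v₃)) =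
      (eU (u₁, u₃), R (eU (u₁, u₃))) + (0, eV (v₁, v₃)) := by simp
  constructor
  · intro h
    have hu : eU (u₁, u₃) ∈ P.map (LinearMap.fst ℝ U V) := ⟨_, h, rfl⟩
    refine ⟨hu, ?_⟩
    rw [split] at h
    exact (P.add_mem_iff_right (key _ hu)).1 h
  · rintro ⟨hu, hv⟩
    rw [split]
    exact P.add_mem (key _ hu) hv

/-- An isomorphism of products that identifies the first factors is block triangular. -/
theorem exists_triangular_of_snd_eq_zero_iff (Ψ : (W₁' × W₃') ≃ₗ[ℝ] (W₁ × W₃))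
    (h : ∀ a b, (Ψ (a, b)).2 = 0 ↔ b = 0) :
    ∃ (α : W₁' ≃ₗ[ℝ] W₁) (β : W₃' →ₗ[ℝ] W₁) (γ : W₃' ≃ₗ[ℝ] W₃),
      ∀ a b, Ψ (a, b) = (α a + β b, γ b) := by
  have split : ∀ a b, Ψ (a, b) = Ψ (a, 0) + Ψ (0, b) := fun a b => by rw [← map_add]; simp
  let α : W₁' →ₗ[ℝ] W₁ := LinearMap.fst ℝ _ _ ∘ₗ Ψ.toLinearMap ∘ₗ LinearMap.inl ℝ _ _
  let γ : W₃' →ₗ[ℝ] W₃ := LinearMap.snd ℝ _ _ ∘ₗ Ψ.toLinearMap ∘ₗ LinearMap.inr ℝ _ _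
  have hα : Function.Bijective α := by
    constructor
    · rw [← LinearMap.ker_eq_bot, LinearMap.ker_eq_bot']
      intro a ha
      have : Ψ (a, 0) = 0 := Prod.ext ha ((h a 0).2 rfl)
      simpa using this
    · intro w
      obtain ⟨⟨a, b⟩, hab⟩ := Ψ.surjective (w, 0)
      obtain rfl : b = 0 := (h a b).1 (by rw [hab])
      exact ⟨a, congrArg Prod.fst hab⟩
  have hγ : Function.Bijective γ := by
    constructor
    · rw [← LinearMap.ker_eq_bot, LinearMap.ker_eq_bot']
      exact fun b hb => (h 0 b).1 hb
    · intro w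
      obtain ⟨⟨a, b⟩, hab⟩ := Ψ.surjective (0, w)
      refine ⟨b, ?_⟩
      have := congrArg Prod.snd (split a b)
      rw [hab, Prod.snd_add, (h a 0).2 rfl, zero_add] at this
      exact this.symm
  refine ⟨LinearEquiv.ofBijective α hα,
    LinearMap.fst ℝ _ _ ∘ₗ Ψ.toLinearMap ∘ₗ LinearMap.inr ℝ _ _,
    LinearEquiv.ofBijective γ hγ, fun a b => ?_⟩
  rw [split]
  refine Prod.ext rfl ?_
  rw [Prod.snd_add, (h a 0).2 rfl, zero_add]
  rfl

end Flag

/-- Every system with inputs `(u, v)` has a triangular form in coordinates, reached by a change of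
inputs that is triangular with respect to `(u, v)`. -/
theorem StateSys.exists_triForm_coordinates {X U V Y : Type} [AddCommGroup X] [Module ℝ X]
    [AddCommGroup U] [Module ℝ U] [AddCommGroup V] [Module ℝ V] [AddCommGroup Y] [Module ℝ Y]
    [FiniteDimensional ℝ X] [FiniteDimensional ℝ U] [FiniteDimensional ℝ V]
    [FiniteDimensional ℝ Y] (S : StateSys X (U × V) Y) :
    ∃ (n₁ n₂ n₃ n₄ m₁ m₃ s₁ s₃ p₃ p₄ : ℕ)
      (T : TriForm (Fin n₁ → ℝ) (Fin n₂ → ℝ) (Fin n₃ → ℝ) (Fin n₄ → ℝ)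
        ((Fin m₁ → ℝ) × (Fin s₁ → ℝ)) ((Fin m₃ → ℝ) × (Fin s₃ → ℝ)) (Fin p₃ → ℝ) (Fin p₄ → ℝ))
      (eU : ((Fin m₁ → ℝ) × (Fin m₃ → ℝ)) ≃ₗ[ℝ] U) (eV : ((Fin s₁ → ℝ) × (Fin s₃ → ℝ)) ≃ₗ[ℝ] V)
      (R : U →ₗ[ℝ] V)
      (N : (((Fin m₁ → ℝ) × (Fin s₁ → ℝ)) × ((Fin m₃ → ℝ) × (Fin s₃ → ℝ))) ≃ₗ[ℝ] (U × V)),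
      (∀ u₁ u₃ v₁ v₃, N ((u₁, v₁), (u₃, v₃)) =
        (eU (u₁, u₃), R (eU (u₁, u₃)) + eV (v₁, v₃))) ∧
      MorseRel N S T.toSys ∧ T.Good := by
  obtain @⟨X₁, X₂, X₃, X₄, W₁, W₃, Y₃, Y₄, _, _, _, _, _, _, _, _, _, _, _, _, _, _, _, _,
    T, N₀, rel, good⟩ := S.triangularizable
  -- The blocks are not assumed finite-dimensional; they inherit this from `X` and `Y` as factors.
  obtain ⟨Tx, Ty, -⟩ := id rel
  have : FiniteDimensional ℝ (X₁ × X₂ × X₃ × X₄) := Tx.finiteDimensional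
  have : FiniteDimensional ℝ (Y₃ × Y₄) := Ty.finiteDimensional
  have : FiniteDimensional ℝ X₁ := Module.Finite.of_surjective
    (LinearMap.fst ℝ X₁ (X₂ × X₃ × X₄)) LinearMap.fst_surjective
  have : FiniteDimensional ℝ (X₂ × X₃ × X₄) := Module.Finite.of_surjective
    (LinearMap.snd ℝ X₁ (X₂ × X₃ × X₄)) LinearMap.snd_surjective
  have : FiniteDimensional ℝ X₂ := Module.Finite.of_surjective
    (LinearMap.fst ℝ X₂ (X₃ × X₄)) LinearMap.fst_surjective
  have : FiniteDimensional ℝ (X₃ × X₄) := Module.Finite.of_surjective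
    (LinearMap.snd ℝ X₂ (X₃ × X₄)) LinearMap.snd_surjective
  have : FiniteDimensional ℝ X₃ := Module.Finite.of_surjective
    (LinearMap.fst ℝ X₃ X₄) LinearMap.fst_surjective
  have : FiniteDimensional ℝ X₄ := Module.Finite.of_surjective
    (LinearMap.snd ℝ X₃ X₄) LinearMap.snd_surjective
  have : FiniteDimensional ℝ Y₃ := Module.Finite.of_surjective
    (LinearMap.fst ℝ Y₃ Y₄) LinearMap.fst_surjective
  have : FiniteDimensional ℝ Y₄ := Module.Finite.of_surjective
    (LinearMap.snd ℝ Y₃ Y₄) LinearMap.snd_surjective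
  -- This kernel is the image of `W₁ × 0` under `N₀`, the input subspace of block 1.
  obtain ⟨m₁, m₃, s₁, s₃, eU, eV, R, hP⟩ := Submodule.exists_adapted_prod
    (LinearMap.ker (LinearMap.snd ℝ W₁ W₃ ∘ₗ N₀.symm.toLinearMap))
  let N : (((Fin m₁ → ℝ) × (Fin s₁ → ℝ)) × ((Fin m₃ → ℝ) × (Fin s₃ → ℝ))) ≃ₗ[ℝ] (U × V) :=
    (LinearEquiv.prodProdProdComm ℝ _ _ _ _).trans (eU.skewProd eV (R ∘ₗ eU.toLinearMap))
  have hN : ∀ u₁ u₃ v₁ v₃, N ((u₁, v₁), (u₃, v₃)) =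
      (eU (u₁, u₃), R (eU (u₁, u₃)) + eV (v₁, v₃)) := fun u₁ u₃ v₁ v₃ => by
    rw [add_comm]
    rfl
  obtain ⟨α, β, γ, hαβγ⟩ := exists_triangular_of_snd_eq_zero_iff (N.trans N₀.symm) (by
    rintro ⟨u₁, v₁⟩ ⟨u₃, v₃⟩
    have := hP u₁ u₃ v₁ v₃
    rw [← hN, LinearMap.mem_ker] at this
    simpa using this)
  let e₁ := (Module.finBasis ℝ X₁).equivFun
  let e₂ := (Module.finBasis ℝ X₂).equivFun
  let e₃ := (Module.finBasis ℝ X₃).equivFun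
  let e₄ := (Module.finBasis ℝ X₄).equivFun
  let f₃ := (Module.finBasis ℝ Y₃).equivFun
  let f₄ := (Module.finBasis ℝ Y₄).equivFun
  refine ⟨_, _, _, _, m₁, m₃, s₁, s₃, _, _, T.transport e₁ e₂ e₃ e₄ f₃ f₄ α β γ, eU, eV, R, N,
    hN, ?_, good.transport ..⟩
  have h := rel.trans (T.morseRel_transport e₁ e₂ e₃ e₄ f₃ f₄ α β γ (N.trans N₀.symm) hαβγ)
  have e : (N.trans N₀.symm).trans N₀ = N := by ext1; simp
  rwa [e] at h

/-! ### From matrix identities to pointwise identities -/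

section Matrices

variable {ι X U V W Y : Type} [Fintype ι] [DecidableEq ι] [Fintype X] [DecidableEq X]
  [Fintype U] [DecidableEq U] [Fintype V] [DecidableEq V] [Fintype W] [DecidableEq W]
  [Fintype Y] [DecidableEq Y]

/-- The invertible matrix of a linear automorphism. -/
def LinearEquiv.toGL (e : (ι → ℝ) ≃ₗ[ℝ] (ι → ℝ)) : GL ι ℝ where
  val := LinearMap.toMatrix' e.toLinearMap
  inv := LinearMap.toMatrix' e.symm.toLinearMap
  val_inv := by rw [← LinearMap.toMatrix'_comp]; simp
  inv_val := by rw [← LinearMap.toMatrix'_comp]; simp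

theorem LinearEquiv.toGL_mulVec (e : (ι → ℝ) ≃ₗ[ℝ] (ι → ℝ)) (x : ι → ℝ) :
    (e.toGL : Matrix ι ι ℝ) *ᵥ x = e x :=
  LinearMap.toMatrix'_mulVec e.toLinearMap x

theorem LinearEquiv.toGL_inv_mulVec (e : (ι → ℝ) ≃ₗ[ℝ] (ι → ℝ)) (x : ι → ℝ) :
    (↑e.toGL⁻¹ : Matrix ι ι ℝ) *ᵥ x = e.symm x :=
  LinearMap.toMatrix'_mulVec e.symm.toLinearMap x

theorem GL.inv_mulVec_mulVec (T : GL ι ℝ) (x : ι → ℝ) :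
    (↑T⁻¹ : Matrix ι ι ℝ) *ᵥ ((T : Matrix ι ι ℝ) *ᵥ x) = x := by
  rw [Matrix.mulVec_mulVec, ← Units.val_mul, inv_mul_cancel, Units.val_one, Matrix.one_mulVec]

theorem GL.mulVec_inv_mulVec (T : GL ι ℝ) (x : ι → ℝ) :
    (T : Matrix ι ι ℝ) *ᵥ ((↑T⁻¹ : Matrix ι ι ℝ) *ᵥ x) = x := by
  rw [Matrix.mulVec_mulVec, ← Units.val_mul, mul_inv_cancel, Units.val_one, Matrix.one_mulVec]

theorem LinSys.MorseEquiv.of_forall {S S' : LinSys X W Y} (Tx : GL X ℝ) (Tw : GL W ℝ)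
    (Ty : GL Y ℝ) (F : Matrix W X ℝ) (K : Matrix X Y ℝ)
    (h : ∀ x w, S'.A *ᵥ (Tx.1 *ᵥ x) + S'.B *ᵥ w =
        Tx.1 *ᵥ (S.A *ᵥ x + S.B *ᵥ (F *ᵥ x + (Tw⁻¹).1 *ᵥ w) +
          K *ᵥ (S.C *ᵥ x + S.D *ᵥ (F *ᵥ x + (Tw⁻¹).1 *ᵥ w))) ∧
      S'.C *ᵥ (Tx.1 *ᵥ x) + S'.D *ᵥ w =
        Ty.1 *ᵥ (S.C *ᵥ x + S.D *ᵥ (F *ᵥ x + (Tw⁻¹).1 *ᵥ w))) :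
    S.MorseEquiv S' := by
  refine ⟨Tx, Tw, Ty, F, K, Matrix.toLin'.injective (LinearMap.ext fun z => ?_)⟩
  obtain ⟨x, w, rfl⟩ : ∃ x w, z = Sum.elim (Tx.1 *ᵥ x) w :=
    ⟨(Tx⁻¹).1 *ᵥ (z ∘ Sum.inl), z ∘ Sum.inr, by
      rw [GL.mulVec_inv_mulVec, Sum.elim_comp_inl_inr]⟩
  simp only [Matrix.toLin'_apply, LinSys.systemMatrix, ← Matrix.mulVec_mulVec,
    Matrix.fromBlocks_mulVec, Sum.elim_comp_inl, Sum.elim_comp_inr, (h x w).1, (h x w).2,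
    GL.inv_mulVec_mulVec, Matrix.zero_mulVec, add_zero, zero_add, Matrix.mulVec_add]

/-- Testing on vectors `(Tx x, u, v)` removes every `Tx⁻¹`. Writing `v'` in terms of `u'` accounts
for both occurrences of `R` in the right factor. -/
theorem EMTran.brings_of_forall (T : EMTran X U V Y) {S S' : ODECS X U V Y}
    (h : ∀ x u v u' v', u' = T.Fu *ᵥ x + (T.Tu⁻¹).1 *ᵥ u →
      v' = T.Fv *ᵥ x + T.R *ᵥ u' + (T.Tv⁻¹).1 *ᵥ v →
      S'.A *ᵥ (T.Tx.1 *ᵥ x) + (S'.Bu *ᵥ u + S'.Bv *ᵥ v) =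
        T.Tx.1 *ᵥ (S.A *ᵥ x + (S.Bu *ᵥ u' + S.Bv *ᵥ v') + T.K *ᵥ (S.C *ᵥ x + S.Du *ᵥ u')) ∧
      S'.C *ᵥ (T.Tx.1 *ᵥ x) + S'.Du *ᵥ u = T.Ty.1 *ᵥ (S.C *ᵥ x + S.Du *ᵥ u')) :
    T.Brings S S' := by
  refine Matrix.toLin'.injective (LinearMap.ext fun z => ?_)
  obtain ⟨x, u, v, rfl⟩ : ∃ x u v, z = Sum.elim (T.Tx.1 *ᵥ x) (Sum.elim u v) :=
    ⟨(T.Tx⁻¹).1 *ᵥ (z ∘ Sum.inl), (z ∘ Sum.inr) ∘ Sum.inl, (z ∘ Sum.inr) ∘ Sum.inr, by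
      rw [GL.mulVec_inv_mulVec, Sum.elim_comp_inl_inr, Sum.elim_comp_inl_inr]⟩
  have h := h x u v _ _ rfl rfl
  have hr : T.right *ᵥ Sum.elim (T.Tx.1 *ᵥ x) (Sum.elim u v) =
      Sum.elim x (Sum.elim (T.Fu *ᵥ x + (T.Tu⁻¹).1 *ᵥ u)
        (T.Fv *ᵥ x + T.R *ᵥ (T.Fu *ᵥ x + (T.Tu⁻¹).1 *ᵥ u) + (T.Tv⁻¹).1 *ᵥ v)) := by
    simp only [EMTran.right, Matrix.fromBlocks_mulVec, Matrix.fromRows_mulVec, Sum.elim_comp_inl,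
      Sum.elim_comp_inr, ← Matrix.mulVec_mulVec, GL.inv_mulVec_mulVec, Matrix.zero_mulVec,
      add_zero, Matrix.add_mulVec, Matrix.mulVec_add]
    congr 1
    ext (i | i)
    · simp
    · simp
      abel
  simp only [Matrix.toLin'_apply, ← Matrix.mulVec_mulVec, hr]
  simp only [ODECS.systemMatrix, EMTran.left, ← Matrix.mulVec_mulVec,
    Matrix.fromBlocks_mulVec, Matrix.fromCols_mulVec, Sum.elim_comp_inl, Sum.elim_comp_inr, h.1,
    h.2, Matrix.zero_mulVec, add_zero, zero_add, ← Matrix.mulVec_add]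

end Matrices

/-! ### Controllability and observability from invariant subspaces -/

section CayleyHamilton

variable {X W Y : Type} [Fintype X] [DecidableEq X] [Fintype W]

theorem Matrix.pow_card_mem_span (A : Matrix X X ℝ) :
    A ^ Fintype.card X ∈
      Submodule.span ℝ (Set.range fun k : Fin (Fintype.card X) => A ^ (k : ℕ)) := by
  rcases isEmpty_or_nonempty X with hX | hX
  · rw [Subsingleton.elim (A ^ Fintype.card X) 0]
    exact zero_mem _
  rw [Matrix.pow_eq_aeval_mod_charpoly]
  have hdeg : (Polynomial.X ^ Fintype.card X %ₘ A.charpoly).natDegree < Fintype.card X := by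
    conv_rhs => rw [← A.charpoly_natDegree_eq_dim]
    apply Polynomial.natDegree_modByMonic_lt _ A.charpoly_monic
    -- The degree bound needs a characteristic polynomial other than `1`, which holds as there is at
    -- least one state.
    intro h
    have := A.charpoly_natDegree_eq_dim
    rw [h, Polynomial.natDegree_one] at this
    exact Fintype.card_ne_zero this.symm
  rw [Polynomial.aeval_eq_sum_range' hdeg]
  refine Submodule.sum_mem _ fun i hi => Submodule.smul_mem _ _ (Submodule.subset_span ?_)
  exact ⟨⟨i, Finset.mem_range.1 hi⟩, rfl⟩

/-- The reachability space contains the image of `B` and is invariant: by Cayley–Hamilton the next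
power of `A` gives nothing new. -/
theorem isControllable_of_forall {A : Matrix X X ℝ} {B : Matrix X W ℝ}
    (h : ∀ P : Submodule ℝ (X → ℝ), (∀ w, B *ᵥ w ∈ P) → (∀ x ∈ P, A *ᵥ x ∈ P) → P = ⊤) :
    IsControllable A B := by
  have hmem : ∀ k : ℕ, k < Fintype.card X → ∀ w, (A ^ k) *ᵥ (B *ᵥ w) ∈
      ⨆ k : Fin (Fintype.card X), LinearMap.range (A ^ (k : ℕ) * B).mulVecLin := by
    intro k hk w
    refine Submodule.mem_iSup_of_mem ⟨k, hk⟩ ⟨w, ?_⟩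
    simp
  have hpow : ∀ w, (A ^ Fintype.card X) *ᵥ (B *ᵥ w) ∈
      ⨆ k : Fin (Fintype.card X), LinearMap.range (A ^ (k : ℕ) * B).mulVecLin := by
    intro w
    have := A.pow_card_mem_span
    generalize A ^ Fintype.card X = M at this ⊢
    induction this using Submodule.span_induction with
    | mem M hM =>
      obtain ⟨k, rfl⟩ := hM
      exact hmem k k.2 w
    | zero => rw [Matrix.zero_mulVec]; exact zero_mem _
    | add M M' _ _ h h' => rw [Matrix.add_mulVec]; exact add_mem h h'
    | smul c M _ h => rw [Matrix.smul_mulVec]; exact Submodule.smul_mem _ _ h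
  refine h _ (fun w => ?_) (fun x hx => ?_)
  -- Without states the supremum is over an empty index set, so the term `k = 0` is unavailable.
  · rcases Nat.eq_zero_or_pos (Fintype.card X) with h0 | h0
    · have := Fintype.card_eq_zero_iff.1 h0
      rw [Subsingleton.elim (B *ᵥ w) 0]
      exact zero_mem _
    · simpa using hmem 0 h0 w
  · induction hx using Submodule.iSup_induction' with
    | mem k x hx =>
      obtain ⟨w, rfl⟩ := hx
      have e : A *ᵥ ((A ^ (k : ℕ) * B).mulVecLin w) = (A ^ ((k : ℕ) + 1)) *ᵥ (B *ᵥ w) := by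
        simp [pow_succ', Matrix.mul_assoc]
      rw [e]
      rcases (Nat.succ_le_of_lt k.2).lt_or_eq with hk | hk
      · exact hmem _ hk w
      · rw [Nat.succ_eq_add_one] at hk
        rw [hk]
        exact hpow w
    | zero => rw [Matrix.mulVec_zero]; exact zero_mem _
    | add x y _ _ hx hy => rw [Matrix.mulVec_add]; exact add_mem hx hy

/-- Dually, the unobservable space lies in `ker C` and is invariant by Cayley–Hamilton. -/
theorem isObservable_of_forall {A : Matrix X X ℝ} {C : Matrix Y X ℝ}
    (h : ∀ P : Submodule ℝ (X → ℝ), (∀ x ∈ P, C *ᵥ x = 0) → (∀ x ∈ P, A *ᵥ x ∈ P) → P = ⊥) :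
    IsObservable C A := by
  refine h _ (fun x hx => ?_) (fun x hx => ?_)
  · rcases Nat.eq_zero_or_pos (Fintype.card X) with h0 | h0
    · have := Fintype.card_eq_zero_iff.1 h0
      rw [Subsingleton.elim x 0, Matrix.mulVec_zero]
    · simpa using (Submodule.mem_iInf _).1 hx ⟨0, h0⟩
  · have hx' : ∀ k : ℕ, k < Fintype.card X → C *ᵥ ((A ^ k) *ᵥ x) = 0 := fun k hk => by
      simpa using (Submodule.mem_iInf _).1 hx ⟨k, hk⟩
    rw [Submodule.mem_iInf]
    intro k
    have e : (C * A ^ (k : ℕ)).mulVecLin (A *ᵥ x) = C *ᵥ ((A ^ ((k : ℕ) + 1)) *ᵥ x) := by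
      simp [pow_succ]
    rw [LinearMap.mem_ker, e]
    rcases (Nat.succ_le_of_lt k.2).lt_or_eq with hk | hk
    · exact hx' _ hk
    · rw [Nat.succ_eq_add_one] at hk
      rw [hk]
      have := A.pow_card_mem_span
      generalize A ^ Fintype.card X = M at this ⊢
      induction this using Submodule.span_induction with
      | mem M hM =>
        obtain ⟨k, rfl⟩ := hM
        exact hx' k k.2
      | zero => simp
      | add M M' _ _ h h' => rw [Matrix.add_mulVec, Matrix.mulVec_add, h, h', add_zero]
      | smul c M _ h => rw [Matrix.smul_mulVec, Matrix.mulVec_smul, h, smul_zero]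

end CayleyHamilton

/-! ### Prime systems in matrix form -/

section Chains

theorem LinSys.chains_dyn {k : ℕ} (σ : Fin k → ℕ) (x : (Σ i, Fin (σ i)) → ℝ) (w : Fin k → ℝ) :
    (chains σ).A *ᵥ x + (chains σ).B *ᵥ w = (StateSys.chainSys σ).dyn (x, w) := by
  ext ⟨i, j⟩
  change (∑ b : Σ i, Fin (σ i), (if i = b.1 ∧ (j : ℕ) + 1 = (b.2 : ℕ) then (1 : ℝ) else 0) * x b) +
    (∑ l : Fin k, (if i = l ∧ (j : ℕ) + 1 = σ i then (1 : ℝ) else 0) * w l) =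
    if h : (j : ℕ) + 1 < σ i then x ⟨i, ⟨j + 1, h⟩⟩ else w i
  by_cases h : (j : ℕ) + 1 < σ i
  · rw [dif_pos h, Finset.sum_eq_single ⟨i, ⟨j + 1, h⟩⟩, Finset.sum_eq_zero]
    · simp
    · intro l _
      rw [if_neg (by omega), zero_mul]
    · rintro ⟨i', j'⟩ _ hne
      rw [if_neg, zero_mul]
      rintro ⟨h1, h2⟩
      dsimp only at h1 h2
      subst h1
      exact hne (by congr 1; exact Fin.ext h2.symm)
    · simp
  · have hj : (j : ℕ) + 1 = σ i := by omega
    rw [dif_neg h, Finset.sum_eq_zero, Finset.sum_eq_single i]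
    · simp [hj]
    · intro l _ hl
      rw [if_neg (fun h => hl h.1.symm), zero_mul]
    · simp
    · rintro ⟨i', j'⟩ _
      rw [if_neg, zero_mul]
      rintro ⟨h1, h2⟩
      dsimp only at h1 h2
      subst h1
      have := j'.2
      omega

theorem LinSys.chains_out {k : ℕ} (σ : Fin k → ℕ) (x : (Σ i, Fin (σ i)) → ℝ) (w : Fin k → ℝ) :
    (chains σ).C *ᵥ x + (chains σ).D *ᵥ w = (StateSys.chainSys σ).out (x, w) := by
  ext i
  change (∑ b : Σ i, Fin (σ i), (if i = b.1 ∧ (b.2 : ℕ) = 0 then (1 : ℝ) else 0) * x b) +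
    (∑ l : Fin k, (if i = l ∧ σ i = 0 then (1 : ℝ) else 0) * w l) =
    if h : 0 < σ i then x ⟨i, ⟨0, h⟩⟩ else w i
  by_cases h : 0 < σ i
  · rw [dif_pos h, Finset.sum_eq_single ⟨i, ⟨0, h⟩⟩, Finset.sum_eq_zero]
    · simp
    · intro l _
      rw [if_neg (by omega), zero_mul]
    · rintro ⟨i', j'⟩ _ hne
      rw [if_neg, zero_mul]
      rintro ⟨h1, h2⟩
      dsimp only at h1 h2
      subst h1
      exact hne (by congr 1; exact Fin.ext h2)
    · simp
  · rw [dif_neg h, Finset.sum_eq_zero, Finset.sum_eq_single i]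
    · simp [show σ i = 0 by omega]
    · intro l _ hl
      rw [if_neg (fun h => hl h.1.symm), zero_mul]
    · simp
    · rintro ⟨i', j'⟩ _
      rw [if_neg, zero_mul]
      rintro ⟨h1, h2⟩
      dsimp only at h1 h2
      subst h1
      have := j'.2
      omega

theorem Matrix.reindex_mulVec {a b a' b' : Type} [Fintype b] [Fintype b'] (e : a ≃ a') (f : b ≃ b')
    (M : Matrix a b ℝ) (x : b → ℝ) :
    Matrix.reindex e f M *ᵥ (x ∘ f.symm) = (M *ᵥ x) ∘ e.symm := by
  rw [Matrix.reindex_apply, Matrix.submatrix_mulVec_equiv]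
  simp [Function.comp_assoc]

variable {X W Y : Type} [Fintype X] [DecidableEq X] [Fintype W] [DecidableEq W]
  [Fintype Y] [DecidableEq Y]

theorem StateSys.Prime.isPrime {V : Type} [AddCommGroup V] [Module ℝ V]
    {S : StateSys (X → ℝ) V (Y → ℝ)} (h : S.Prime) (e : V ≃ₗ[ℝ] (W → ℝ)) (L : LinSys X W Y)
    (hdyn : ∀ x w, L.A *ᵥ x + L.B *ᵥ e w = S.dyn (x, w))
    (hout : ∀ x w, L.C *ᵥ x + L.D *ᵥ e w = S.out (x, w)) : L.IsPrime := by
  obtain ⟨κ, _, σ, N, Tx, Ty, F, K, h⟩ := h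
  let r : Fin (Fintype.card κ) ≃ κ := (Fintype.equivFin κ).symm
  let rs : (Σ i, Fin (σ (r i))) ≃ (Σ i, Fin (σ i)) :=
    Equiv.sigmaCongrLeft (β := fun i => Fin (σ i)) r
  -- Any bijections of index sets will do, since the invertible matrices absorb the choice; the
  -- linear isomorphisms supply equality of cardinalities.
  let eX : (Σ i, Fin (σ (r i))) ≃ X :=
    rs.trans (Fintype.equivOfCardEq (card_eq_of_linearEquiv ℝ Tx).symm)
  let eW : Fin (Fintype.card κ) ≃ W :=
    r.trans (Fintype.equivOfCardEq (card_eq_of_linearEquiv ℝ (N.trans e)))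
  let eY : Fin (Fintype.card κ) ≃ Y :=
    r.trans (Fintype.equivOfCardEq (card_eq_of_linearEquiv ℝ Ty).symm)
  let tx : (X → ℝ) ≃ₗ[ℝ] (X → ℝ) :=
    Tx.trans (LinearEquiv.funCongrLeft ℝ ℝ (eX.symm.trans rs))
  let ty : (Y → ℝ) ≃ₗ[ℝ] (Y → ℝ) :=
    Ty.trans (LinearEquiv.funCongrLeft ℝ ℝ (eY.symm.trans r))
  let tw : (W → ℝ) ≃ₗ[ℝ] (W → ℝ) :=
    e.symm.trans (N.symm.trans (LinearEquiv.funCongrLeft ℝ ℝ (eW.symm.trans r)))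
  refine ⟨Fintype.card κ, σ ∘ r, eX, eW, eY, LinSys.MorseEquiv.of_forall tx.toGL tw.toGL ty.toGL
    (LinearMap.toMatrix' (e.toLinearMap ∘ₗ F)) (LinearMap.toMatrix' K) fun x w => ?_⟩
  obtain ⟨w, rfl⟩ := tw.surjective w
  obtain ⟨w, rfl⟩ := (N.trans e).surjective w
  have hw : LinearMap.toMatrix' (e.toLinearMap ∘ₗ F) *ᵥ x +
      (tw.toGL⁻¹).1 *ᵥ tw ((N.trans e) w) = e (F x + N w) := by
    rw [LinearEquiv.toGL_inv_mulVec, LinearMap.toMatrix'_mulVec, LinearEquiv.symm_apply_apply]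
    simp
  rw [hw, hdyn, hout, LinearEquiv.toGL_mulVec, LinearEquiv.toGL_mulVec, LinearEquiv.toGL_mulVec,
    LinearMap.toMatrix'_mulVec]
  have htw : tw ((N.trans e) w) = (w ∘ r) ∘ eW.symm := by
    simp only [tw, LinearEquiv.trans_apply, LinearEquiv.symm_apply_apply]
    rfl
  have htx : ∀ x, tx x = (Tx x ∘ rs) ∘ eX.symm := fun x => rfl
  have hty : ∀ y, ty y = (Ty y ∘ r) ∘ eY.symm := fun y => rfl
  rw [htw, htx, htx, hty, ← (h x w).1, ← (h x w).2]
  simp only [LinSys.reindex, Matrix.reindex_mulVec]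
  constructor
  · exact congrArg (· ∘ eX.symm) (LinSys.chains_dyn (σ ∘ r) (Tx x ∘ rs) (w ∘ r))
  · exact congrArg (· ∘ eY.symm) (LinSys.chains_out (σ ∘ r) (Tx x ∘ rs) (w ∘ r))

end Chains

/-! ### Assembling the block matrices -/

/-- Vectors indexed by a disjoint union. -/
def sumVec (a b : Type) : ((a → ℝ) × (b → ℝ)) ≃ₗ[ℝ] (a ⊕ b → ℝ) :=
  (LinearEquiv.sumArrowLequivProdArrow a b ℝ ℝ).symm

theorem sumVec_apply {a b : Type} (x : a → ℝ) (y : b → ℝ) : sumVec a b (x, y) = Sum.elim x y := by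
  ext (i | i) <;> rfl

/-- Vectors indexed by a disjoint union of four types. -/
def sumVec₄ (a b c d : Type) :
    ((a → ℝ) × (b → ℝ) × (c → ℝ) × (d → ℝ)) ≃ₗ[ℝ] (a ⊕ (b ⊕ (c ⊕ d)) → ℝ) :=
  ((LinearEquiv.refl ℝ _).prodCongr (((LinearEquiv.refl ℝ _).prodCongr (sumVec c d)).trans
    (sumVec b (c ⊕ d)))).trans (sumVec a (b ⊕ (c ⊕ d)))

theorem sumVec₄_apply {a b c d : Type} (x : a → ℝ) (y : b → ℝ) (z : c → ℝ) (t : d → ℝ) :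
    sumVec₄ a b c d (x, y, z, t) = Sum.elim x (Sum.elim y (Sum.elim z t)) := by
  simp [sumVec₄, sumVec_apply]

namespace TriForm

variable {n₁ n₂ n₃ n₄ m₁ m₃ s₁ s₃ p₃ p₄ : ℕ}

/-- The matrices of the blocks of a triangular form. -/
noncomputable def toEMTF (T : TriForm (Fin n₁ → ℝ) (Fin n₂ → ℝ) (Fin n₃ → ℝ) (Fin n₄ → ℝ)
      ((Fin m₁ → ℝ) × (Fin s₁ → ℝ)) ((Fin m₃ → ℝ) × (Fin s₃ → ℝ)) (Fin p₃ → ℝ) (Fin p₄ → ℝ)) :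
    EMTF n₁ n₂ n₃ n₄ m₁ m₃ s₁ s₃ p₃ p₄ where
  A₁ := LinearMap.toMatrix' T.A₁
  A₁₂ := LinearMap.toMatrix' (T.M ∘ₗ LinearMap.inl ℝ _ _ ∘ₗ LinearMap.inl ℝ _ _)
  A₁₃ := LinearMap.toMatrix'
    (T.M ∘ₗ LinearMap.inl ℝ _ _ ∘ₗ LinearMap.inr ℝ _ _ ∘ₗ LinearMap.inl ℝ _ _)
  A₁₄ := LinearMap.toMatrix'
    (T.M ∘ₗ LinearMap.inl ℝ _ _ ∘ₗ LinearMap.inr ℝ _ _ ∘ₗ LinearMap.inr ℝ _ _)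
  A₂ := LinearMap.toMatrix' T.A₂
  A₂₄ := LinearMap.toMatrix' T.A₂₄
  A₃ := LinearMap.toMatrix' (T.S₃.dyn ∘ₗ LinearMap.inl ℝ _ _)
  A₃₄ := LinearMap.toMatrix' T.A₃₄
  A₄ := LinearMap.toMatrix' T.A₄
  Bu₁ := LinearMap.toMatrix' (T.B₁ ∘ₗ LinearMap.inl ℝ _ _)
  Bu₁₂ := LinearMap.toMatrix' (T.M ∘ₗ LinearMap.inr ℝ _ _ ∘ₗ LinearMap.inl ℝ _ _)
  Bu₃ := LinearMap.toMatrix' (T.S₃.dyn ∘ₗ LinearMap.inr ℝ _ _ ∘ₗ LinearMap.inl ℝ _ _)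
  Bv₁ := LinearMap.toMatrix' (T.B₁ ∘ₗ LinearMap.inr ℝ _ _)
  Bv₁₂ := LinearMap.toMatrix' (T.M ∘ₗ LinearMap.inr ℝ _ _ ∘ₗ LinearMap.inr ℝ _ _)
  Bv₃ := LinearMap.toMatrix' (T.S₃.dyn ∘ₗ LinearMap.inr ℝ _ _ ∘ₗ LinearMap.inr ℝ _ _)
  C₃ := LinearMap.toMatrix' (T.S₃.out ∘ₗ LinearMap.inl ℝ _ _)
  C₃₄ := LinearMap.toMatrix' T.C₃₄
  C₄ := LinearMap.toMatrix' T.C₄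
  Du₃ := LinearMap.toMatrix' (T.S₃.out ∘ₗ LinearMap.inr ℝ _ _ ∘ₗ LinearMap.inl ℝ _ _)

variable (T : TriForm (Fin n₁ → ℝ) (Fin n₂ → ℝ) (Fin n₃ → ℝ) (Fin n₄ → ℝ)
      ((Fin m₁ → ℝ) × (Fin s₁ → ℝ)) ((Fin m₃ → ℝ) × (Fin s₃ → ℝ)) (Fin p₃ → ℝ) (Fin p₄ → ℝ))

theorem B₁_split (u₁ : Fin m₁ → ℝ) (v₁ : Fin s₁ → ℝ) :
    T.B₁ (u₁, v₁) = T.B₁ (u₁, 0) + T.B₁ (0, v₁) := by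
  simp [← map_add]

theorem M_split (x₂ : Fin n₂ → ℝ) (x₃ : Fin n₃ → ℝ) (x₄ : Fin n₄ → ℝ) (u₃ : Fin m₃ → ℝ)
    (v₃ : Fin s₃ → ℝ) :
    T.M ((x₂, x₃, x₄), (u₃, v₃)) = T.M ((x₂, 0), 0) + T.M ((0, x₃, 0), 0) +
      T.M ((0, 0, x₄), 0) + T.M (0, (u₃, 0)) + T.M (0, (0, v₃)) := by
  simp only [← map_add]
  congr 1
  ext <;> simp

theorem dyn₃_split (x₃ : Fin n₃ → ℝ) (u₃ : Fin m₃ → ℝ) (v₃ : Fin s₃ → ℝ) :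
    T.S₃.dyn (x₃, (u₃, v₃)) =
      T.S₃.dyn (x₃, 0) + T.S₃.dyn (0, (u₃, 0)) + T.S₃.dyn (0, (0, v₃)) := by
  simp [← map_add]

/-- The matrix form has no slot for a feedthrough of `v₃`; the hypothesis `h` says that none is
needed. -/
theorem out₃_split (h : ∀ v₃, T.S₃.out (0, (0, v₃)) = 0) (x₃ : Fin n₃ → ℝ) (u₃ : Fin m₃ → ℝ)
    (v₃ : Fin s₃ → ℝ) :
    T.S₃.out (x₃, (u₃, v₃)) = T.S₃.out (x₃, 0) + T.S₃.out (0, (u₃, 0)) := by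
  rw [← add_zero (_ + _), ← h v₃]
  simp [← map_add]

theorem toEMTF_dyn (x₁ x₂ x₃ x₄ u₁ u₃ v₁ v₃) :
    T.toEMTF.toODECS.A *ᵥ sumVec₄ _ _ _ _ (x₁, x₂, x₃, x₄) +
      (T.toEMTF.toODECS.Bu *ᵥ sumVec _ _ (u₁, u₃) + T.toEMTF.toODECS.Bv *ᵥ sumVec _ _ (v₁, v₃)) =
      sumVec₄ _ _ _ _ (T.toSys.dyn ((x₁, x₂, x₃, x₄), ((u₁, v₁), (u₃, v₃)))) := by
  rw [toSys_dyn, B₁_split, M_split, dyn₃_split]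
  simp only [sumVec₄_apply, sumVec_apply, EMTF.toODECS, toEMTF, Matrix.fromBlocks_mulVec,
    Matrix.fromCols_mulVec, Matrix.fromRows_mulVec, Sum.elim_comp_inl, Sum.elim_comp_inr,
    LinearMap.toMatrix'_mulVec, Matrix.zero_mulVec, LinearMap.comp_apply, LinearMap.inl_apply,
    LinearMap.inr_apply, zero_add]
  ext (i | i | i | i)
  · simp only [Pi.add_apply, Sum.elim_inl, Prod.zero_eq_mk]
    abel
  · simp
  · simp only [Pi.add_apply, Sum.elim_inl, Sum.elim_inr, Prod.zero_eq_mk]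
    abel
  · simp

theorem toEMTF_out (h : ∀ v₃, T.S₃.out (0, (0, v₃)) = 0) (x₁ x₂ x₃ x₄ u₁ u₃ v₁ v₃) :
    T.toEMTF.toODECS.C *ᵥ sumVec₄ _ _ _ _ (x₁, x₂, x₃, x₄) +
      T.toEMTF.toODECS.Du *ᵥ sumVec _ _ (u₁, u₃) =
      sumVec _ _ (T.toSys.out ((x₁, x₂, x₃, x₄), ((u₁, v₁), (u₃, v₃)))) := by
  rw [toSys_out, T.out₃_split h]
  simp only [sumVec₄_apply, sumVec_apply, EMTF.toODECS, toEMTF, Matrix.fromBlocks_mulVec,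
    Matrix.fromCols_mulVec, Sum.elim_comp_inl, Sum.elim_comp_inr,
    LinearMap.toMatrix'_mulVec, Matrix.zero_mulVec, LinearMap.comp_apply, LinearMap.inl_apply,
    LinearMap.inr_apply, zero_add]
  ext (i | i)
  · simp only [Pi.add_apply, Sum.elim_inl, Prod.zero_eq_mk]
    abel
  · simp

variable {T}

theorem Good.isControllable (h : T.Good) :
    IsControllable T.toEMTF.A₁ (Matrix.fromCols T.toEMTF.Bu₁ T.toEMTF.Bv₁) := by
  refine isControllable_of_forall fun P hB hA => h.controllable P ?_ fun x hx => ?_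
  · rintro ⟨u, v⟩
    have := hB (Sum.elim u v)
    rw [B₁_split]
    simpa [toEMTF, Matrix.fromCols_mulVec] using this
  · simpa [toEMTF] using hA x hx

theorem Good.isObservable (h : T.Good) : IsObservable T.toEMTF.C₄ T.toEMTF.A₄ := by
  refine isObservable_of_forall fun P hC hA => h.observable P (fun x hx => ?_) fun x hx => ?_
  · simpa [toEMTF] using hC x hx
  · simpa [toEMTF] using hA x hx

theorem Good.isPrime (h : T.Good) (h₀ : ∀ v₃, T.S₃.out (0, (0, v₃)) = 0) :
    T.toEMTF.block₃.IsPrime := by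
  refine h.prime.isPrime (sumVec _ _) _ ?_ ?_
  · rintro x ⟨u, v⟩
    rw [dyn₃_split, sumVec_apply]
    simp [EMTF.block₃, toEMTF, Matrix.fromCols_mulVec, add_assoc]
  · rintro x ⟨u, v⟩
    rw [T.out₃_split h₀, sumVec_apply]
    simp [EMTF.block₃, toEMTF, Matrix.fromCols_mulVec]

end TriForm

/-! ### The extended Morse triangular form -/

theorem theorem2 (n m s p : ℕ) (S : ODECS (Fin n) (Fin m) (Fin s) (Fin p)) :
    ∃ (T : EMTran (Fin n) (Fin m) (Fin s) (Fin p)) (S' : ODECS (Fin n) (Fin m) (Fin s) (Fin p)),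
      T.Brings S S' ∧
      ∃ (n₁ n₂ n₃ n₄ m₁ m₃ s₁ s₃ p₃ p₄ : ℕ)
        (hn : n = n₁ + (n₂ + (n₃ + n₄))) (hm : m = m₁ + m₃) (hs : s = s₁ + s₃) (hp : p = p₃ + p₄)
        (E : EMTF n₁ n₂ n₃ n₄ m₁ m₃ s₁ s₃ p₃ p₄),
        S' = E.toODECS.reindex (blocks₄ hn) (blocks₂ hm) (blocks₂ hs) (blocks₂ hp) ∧
        IsControllable E.A₁ (Matrix.fromCols E.Bu₁ E.Bv₁) ∧
        IsObservable E.C₄ E.A₄ ∧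
        E.block₃.IsPrime := by
  let S₀ : StateSys (Fin n → ℝ) ((Fin m → ℝ) × (Fin s → ℝ)) (Fin p → ℝ) :=
    { dyn := S.A.mulVecLin.coprod (S.Bu.mulVecLin.coprod S.Bv.mulVecLin)
      out := S.C.mulVecLin.coprod (S.Du.mulVecLin ∘ₗ LinearMap.fst ℝ _ _) }
  obtain ⟨n₁, n₂, n₃, n₄, m₁, m₃, s₁, s₃, p₃, p₄, T, eU, eV, R, N, hN, ⟨Tx, Ty, F, K, rel⟩, good⟩ :=
    S₀.exists_triForm_coordinates
  have hn : n = n₁ + (n₂ + (n₃ + n₄)) := by simpa using Tx.finrank_eq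
  have hm : m = m₁ + m₃ := by simpa using eU.finrank_eq.symm
  have hs : s = s₁ + s₃ := by simpa using eV.finrank_eq.symm
  have hp : p = p₃ + p₄ := by simpa using Ty.finrank_eq
  -- At `x = 0` the feedback vanishes and the input `v₃` alone gives `u = 0`, since `N` never sends
  -- `v`-coordinates into `U`; the original output does not see `v`.
  have h₀ : ∀ v₃, T.S₃.out (0, (0, v₃)) = 0 := by
    intro v₃
    have h := (rel 0 ((0, 0), (0, v₃))).2
    rw [hN, map_zero, map_zero, zero_add] at h
    have h' : S₀.out (0, (eU (0, 0), R (eU (0, 0)) + eV (0, v₃))) = 0 := by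
      have : eU (0, 0) = 0 := map_zero eU
      simp [S₀, this]
    rw [h', map_zero] at h
    have h'' := congrArg Prod.fst (T.toSys_out 0 0 0 0 (0, 0) (0, v₃))
    simp only [map_zero, add_zero] at h''
    rw [← h'']
    exact congrArg Prod.fst h
  let tx : (Fin n → ℝ) ≃ₗ[ℝ] (Fin n → ℝ) :=
    (Tx.trans (sumVec₄ _ _ _ _)).trans (LinearEquiv.funCongrLeft ℝ ℝ (blocks₄ hn).symm)
  let tu : (Fin m → ℝ) ≃ₗ[ℝ] (Fin m → ℝ) :=
    (eU.symm.trans (sumVec _ _)).trans (LinearEquiv.funCongrLeft ℝ ℝ (blocks₂ hm).symm)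
  let tv : (Fin s → ℝ) ≃ₗ[ℝ] (Fin s → ℝ) :=
    (eV.symm.trans (sumVec _ _)).trans (LinearEquiv.funCongrLeft ℝ ℝ (blocks₂ hs).symm)
  let ty : (Fin p → ℝ) ≃ₗ[ℝ] (Fin p → ℝ) :=
    (Ty.trans (sumVec _ _)).trans (LinearEquiv.funCongrLeft ℝ ℝ (blocks₂ hp).symm)
  let G : EMTran (Fin n) (Fin m) (Fin s) (Fin p) :=
    { Tx := tx.toGL
      Tu := tu.toGL
      Tv := tv.toGL
      Ty := ty.toGL
      Fu := LinearMap.toMatrix' (LinearMap.fst ℝ _ _ ∘ₗ F)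
      -- The right factor contains `Fv + R Fu`, so `R Fu` is subtracted from the `V`-component of
      -- the feedback.
      Fv := LinearMap.toMatrix' (LinearMap.snd ℝ _ _ ∘ₗ F - R ∘ₗ LinearMap.fst ℝ _ _ ∘ₗ F)
      R := LinearMap.toMatrix' R
      K := LinearMap.toMatrix' K }
  refine ⟨G, _, EMTran.brings_of_forall G ?_, n₁, n₂, n₃, n₄, m₁, m₃, s₁, s₃, p₃, p₄, hn, hm, hs,
    hp, T.toEMTF, rfl, good.isControllable, good.isObservable, good.isPrime h₀⟩
  intro x u v u' v' hu' hv'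
  obtain ⟨u, rfl⟩ := tu.surjective u
  obtain ⟨⟨u₁, u₃⟩, rfl⟩ := eU.surjective u
  obtain ⟨v, rfl⟩ := tv.surjective v
  obtain ⟨⟨v₁, v₃⟩, rfl⟩ := eV.surjective v
  have hw : F x + N ((u₁, v₁), (u₃, v₃)) = (u', v') := by
    have hu : u' = (F x).1 + eU (u₁, u₃) := by
      simp only [hu', G, LinearEquiv.toGL_inv_mulVec, LinearMap.toMatrix'_mulVec,
        LinearEquiv.symm_apply_apply, LinearMap.comp_apply, LinearMap.fst_apply]
    have hv : v' = (F x).2 + (R (eU (u₁, u₃)) + eV (v₁, v₃)) := by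
      rw [hv', hu]
      simp only [G, LinearEquiv.toGL_inv_mulVec, LinearMap.toMatrix'_mulVec, map_add,
        LinearEquiv.symm_apply_apply, LinearMap.comp_apply, LinearMap.fst_apply,
        LinearMap.snd_apply, LinearMap.sub_apply]
      abel
    rw [hN, hu, hv]
    rfl
  have hdyn : S.A *ᵥ x + (S.Bu *ᵥ u' + S.Bv *ᵥ v') = S₀.dyn (x, (u', v')) := rfl
  have hout : S.C *ᵥ x + S.Du *ᵥ u' = S₀.out (x, (u', v')) := rfl
  have htx : ∀ z, tx z = sumVec₄ _ _ _ _ (Tx z) ∘ (blocks₄ hn).symm := fun z => rfl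
  have hty : ∀ z, ty z = sumVec _ _ (Ty z) ∘ (blocks₂ hp).symm := fun z => rfl
  have htu : tu (eU (u₁, u₃)) = sumVec _ _ (u₁, u₃) ∘ (blocks₂ hm).symm := by
    change sumVec _ _ (eU.symm (eU (u₁, u₃))) ∘ _ = _
    rw [LinearEquiv.symm_apply_apply]
  have htv : tv (eV (v₁, v₃)) = sumVec _ _ (v₁, v₃) ∘ (blocks₂ hs).symm := by
    change sumVec _ _ (eV.symm (eV (v₁, v₃))) ∘ _ = _
    rw [LinearEquiv.symm_apply_apply]
  have rel' := rel x ((u₁, v₁), (u₃, v₃))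
  rw [hw] at rel'
  simp only [G, LinearEquiv.toGL_mulVec, LinearMap.toMatrix'_mulVec, hdyn, hout]
  rw [htx x, htx, hty, htu, htv, ← rel'.1, ← rel'.2]
  simp only [ODECS.reindex, Matrix.reindex_mulVec]
  obtain ⟨⟨x₁, x₂, x₃, x₄⟩, hx⟩ : ∃ z, Tx x = z := ⟨_, rfl⟩
  rw [hx]
  exact ⟨congrArg (· ∘ (blocks₄ hn).symm) (T.toEMTF_dyn x₁ x₂ x₃ x₄ u₁ u₃ v₁ v₃),
    congrArg (· ∘ (blocks₂ hp).symm) (T.toEMTF_out h₀ x₁ x₂ x₃ x₄ u₁ u₃ v₁ v₃)⟩
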